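/- **Theorem (performance of MultiBags+).** Consider task-parallel programs whose instructions are unit-cost computation steps, reads and writes of memory locations, ordinary calls, $\mathtt{spawn}$ of a function, $\mathtt{sync}$ (which joins all children spawned so far by the current function instance, and is performed implicitly when a function returns), $\mathtt{create}$ of a future, and $\mathtt{get}$ of a future. Futures are general (unstructured): any function instance may $\mathtt{get}$ any future, any number of times. The program is run sequentially in depth-first eager order, so that the body of a spawned function or of a future runs to completion before the continuation of its creator, and this run reaches its end, i.e. every $\mathtt{get}$ refers to a future that has already completed. For the run let * $T_1$ be the work, i.e. the number of instructions executed; * $m$ be the number of memory accesses; * $n$ be the number of $\mathtt{spawn}$ and $\mathtt{create}$ operations; * $k$ be the number of $\mathtt{create}$ and $\mathtt{get}$ operations; * $\alpha(m,n)=\min\{i\ge 1 : A(i,\lfloor m/n\rfloor)\ge\log_2 n\}$ be the inverse Ackermann function, where $A$ is the Ackermann–Péter function (and $\alpha(m,0)=1$). MultiBags+ is the following on-the-fly race detector. It keeps two disjoint-set structures over the strands (union by rank, path compression) and a reachability matrix $\mathcal R$. A strand is a maximal run of instructions without parallel control; a $\mathtt{sync}$ is treated as a sequence of binary joins, most recent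 child first. * $D_{SP}$. The first strand of every function instance $F$ starts an $S$-bag $S_F$, to which the later strands of $F$ are added. When a spawned function or future $G$ returns, its $S$-bag becomes a $P$-bag $P_G$; when $F$ joins a spawned $G$, $P_G$ is merged into $S_F$; a $\mathtt{get}$ merges nothing. * $D_{NSP}$ and $\mathcal R$. Every set of $D_{NSP}$ is either attached, and then is a node of $\mathcal R$, or unattached, and then has an attached predecessor and possibly an attached successor. To attachify an unattached set is to insert it into $\mathcal R$ with an arc from its attached predecessor. The very first strand is attached. * At a $\mathtt{spawn}$ ending strand $f$, the first strands of the child and of the continuation become unattached sets, whose attached predecessor is the set of $f$ if that is attached and the attached predecessor of this set otherwise. * At a $\mathtt{create}$ ending strand $u$, the set of $u$ is attachified, and the first strands of the future and of the continuation become attached sets with an arc from the set of $u$. * At a $\mathtt{get}$ ending strand $u$, the set of $u$ is attachified, and the next strand becomes an attached set with arcs from the set of $u$ and from the set of the last strand of the future. * At a join strand $j$ that closes the spawn ending strand $f$, let the two branches have first strands $s_1,s_2$ and last strands $t_1,t_2$. If $t_1,t_2$ are both in unattached sets, these sets and $j$ are merged into the set of $f$. If both are in attached sets, the set of $f$ is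 attachified, with arcs to the sets of $s_1$ and $s_2$, and $j$ becomes an attached set with arcs from those of $t_1$ and $t_2$. If only $t_a$ is in an attached set, the set of $f$ is merged into that of $s_a$ if it is unattached, $j$ is merged into the set of $t_a$, and this set becomes the attached successor of the set of the other last strand. * Inserting a node into $\mathcal R$ computes its row and its column of the reachability matrix from those of its given neighbours. * Query whether an earlier strand $u$ precedes the current strand $v$: yes if $u$ is in an $S$-bag. Otherwise let $a$ be the set of $u$ in $D_{NSP}$ if attached, else its attached successor (if there is none, the answer is no), and let $b$ be the set of $v$ if attached, else its attached predecessor; answer whether $a$ reaches $b$ in $\mathcal R$. * Every location stores its last writer and the readers since the last write. A read queries the last writer against the current strand, a write queries the last writer and all these readers and then clears the readers; every negative answer is reported as a race. The running time counts one step for every instruction of the program and for every table entry read or written by the detector. Then there is an absolute constant $C$ such that, for every such program, the execution together with race detection by MultiBags+ takes at most $$C\,\bigl(T_1\,\alpha(m,n)+k^2\bigr)$$ steps in total. Moreover, MultiBags+ creates at most $C(k+1)$ attached sets, and the insertion of each of them into $\mathcal R$ takes at most $C(k+1)$ steps. -/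

import Mathlib

namespace FutureRace

/-! ### Programs with general futures -/

/-- The unfolding of one function instance, as met by the sequential depth-first eager execution:
the instructions that the instance performs, in order, up to its `ret`.  Memory locations are
numbered.  Futures are numbered `0, 1, 2, …` in the order in which the sequential execution creates
them, and `get i` joins future number `i`; a future may be joined any number of times (or never),
by any function instance.  `sync` joins all the children that the instance has spawned so far, and
there is an implicit `sync` at `ret`; futures are joined by `get` only.  `call` is an ordinary
sequential call. -/
inductive Code : Type
  | ret : Code
  | compute (rest : Code) : Code
  | read (l : ℕ) (rest : Code) : Code
  | write (l : ℕ) (rest : Code) : Code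
  | call (body rest : Code) : Code
  | spawn (body rest : Code) : Code
  | create (body rest : Code) : Code
  | get (i : ℕ) (rest : Code) : Code
  | sync (rest : Code) : Code

namespace Code

/-- The work `T₁`: the number of instructions executed. -/
def work : Code → ℕ
  | ret => 1
  | compute r => r.work + 1
  | read _ r => r.work + 1
  | write _ r => r.work + 1
  | call b r => b.work + r.work + 1
  | spawn b r => b.work + r.work + 1
  | create b r => b.work + r.work + 1
  | get _ r => r.work + 1
  | sync r => r.work + 1

/-- The number `m` of memory accesses. -/
def accesses : Code → ℕ
  | ret => 0
  | compute r => r.accesses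
  | read _ r => r.accesses + 1
  | write _ r => r.accesses + 1
  | call b r => b.accesses + r.accesses
  | spawn b r => b.accesses + r.accesses
  | create b r => b.accesses + r.accesses
  | get _ r => r.accesses
  | sync r => r.accesses

/-- The number `n` of places at which parallelism is created: `spawn` and `create` operations. -/
def forks : Code → ℕ
  | ret => 0
  | compute r => r.forks
  | read _ r => r.forks
  | write _ r => r.forks
  | call b r => b.forks + r.forks
  | spawn b r => b.forks + r.forks + 1
  | create b r => b.forks + r.forks + 1
  | get _ r => r.forks
  | sync r => r.forks

/-- The number `k` of future operations: `create` and `get`. -/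
def futureOps : Code → ℕ
  | ret => 0
  | compute r => r.futureOps
  | read _ r => r.futureOps
  | write _ r => r.futureOps
  | call b r => b.futureOps + r.futureOps
  | spawn b r => b.futureOps + r.futureOps
  | create b r => b.futureOps + r.futureOps + 1
  | get _ r => r.futureOps + 1
  | sync r => r.futureOps

/-- Depth-first eager execution as far as futures are concerned: the state is the number of futures
created so far and the set of those that have completed.  A spawned or created body runs to
completion before its continuation.  A `get` of a future that has not completed blocks (`none`). -/
def eager : Code → ℕ × Finset ℕ → Option (ℕ × Finset ℕ)
  | ret, s => some s
  | compute r, s => r.eager s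
  | read _ r, s => r.eager s
  | write _ r, s => r.eager s
  | call b r, s => (b.eager s).bind r.eager
  | spawn b r, s => (b.eager s).bind r.eager
  | create b r, s => (b.eager (s.1 + 1, s.2)).bind fun s' => r.eager (s'.1, insert s.1 s'.2)
  | get i r, s => if i ∈ s.2 then r.eager s else none
  | sync r, s => r.eager s

/-- The depth-first eager execution of the program runs to its end: every `get` refers to a future
that has completed by then. -/
def Runs (p : Code) : Prop := (p.eager (0, ∅)).isSome

end Code

/-! ### The inverse Ackermann function -/

/-- `α(m, n) = min {i ≥ 1 : A(i, ⌊m / n⌋) ≥ log₂ n}`, with the Ackermann–Péter function `A`.  As `A`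
takes integer values, `log₂ n` may be rounded up. -/
noncomputable def invAck (m n : ℕ) : ℕ :=
  sInf {i : ℕ | 1 ≤ i ∧ Nat.clog 2 n ≤ ack i (m / n)}

/-! ### Disjoint sets: union by rank and path compression, with step counts -/

/-- A disjoint-set forest on the elements `0, …, size - 1`. -/
structure Forest where
  size : ℕ
  parent : ℕ → ℕ
  rank : ℕ → ℕ

namespace Forest

def empty : Forest := ⟨0, id, fun _ => 0⟩

/-- Make-Set: the new element is `d.size`. -/
def makeSet (d : Forest) : Forest :=
  ⟨d.size + 1, Function.update d.parent d.size d.size, Function.update d.rank d.size 0⟩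

/-- Find with path compression along at most `fuel` parent links: the representative, the
compressed forest, and the number of steps (one for each parent entry read or written). -/
def findAux (d : Forest) : ℕ → ℕ → ℕ × Forest × ℕ
  | 0, x => (x, d, 1)
  | fuel + 1, x =>
    if d.parent x = x then (x, d, 1)
    else
      let res := findAux d fuel (d.parent x)
      (res.1, { res.2.1 with parent := Function.update res.2.1.parent x res.1 }, res.2.2 + 2)

/-- Find.  A path to a root has fewer than `d.size` links, so that the fuel never runs out. -/
def find (d : Forest) (x : ℕ) : ℕ × Forest × ℕ := d.findAux d.size x

/-- Union: the new representative, the new forest, and the number of steps. -/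
def union (d : Forest) (x y : ℕ) : ℕ × Forest × ℕ :=
  let fx := d.find x
  let fy := fx.2.1.find y
  let e := fy.2.1
  let a := fx.1
  let b := fy.1
  let c := fx.2.2 + fy.2.2 + 4
  if a = b then (a, e, c)
  else if e.rank a < e.rank b then
    (b, { e with parent := Function.update e.parent a b }, c)
  else if e.rank b < e.rank a then
    (a, { e with parent := Function.update e.parent b a }, c)
  else
    (a, { e with
      parent := Function.update e.parent b a
      rank := Function.update e.rank a (e.rank a + 1) }, c)

end Forest

/-! ### The detector

Strands (maximal runs of instructions without parallel control) are numbered in the order in which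
they are allocated; they are the elements of both disjoint-set structures.  Tables are functions on
`ℕ`.  Every operation charges one step for each table entry that it reads or writes and for each
instruction of the program. -/

structure Detector where
  /-- `D_SP`, whose sets are the `S`- and `P`-bags of function instances -/
  sp : Forest
  /-- for a representative of `D_SP`: is the set an `S`-bag (otherwise a `P`-bag)? -/
  isS : ℕ → Bool
  /-- `D_NSP`, whose sets are the attached and unattached sets -/
  nsp : Forest
  /-- for a representative of `D_NSP`: the node of `R` if the set is attached, `none` otherwise -/
  att : ℕ → Option ℕ
  /-- for a representative of an unattached set: its attached predecessor (a node of `R`) -/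
  attPred : ℕ → ℕ
  /-- for a representative of an unattached set: its attached successor, if there is one -/
  attSucc : ℕ → Option ℕ
  /-- number of nodes of `R` -/
  rSize : ℕ
  /-- the strict reachability matrix of `R`, which is kept transitively closed -/
  reach : ℕ → ℕ → Bool
  /-- number of futures created so far -/
  futCount : ℕ
  /-- the last strand of a completed future -/
  futLast : ℕ → ℕ
  /-- access history: the strand that last wrote a location -/
  lastWriter : ℕ → Option ℕ
  /-- access history: the strands that have read a location since it was last written -/
  readers : ℕ → List ℕ
  /-- races reported: location, earlier strand, later strand -/
  races : List (ℕ × ℕ × ℕ)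
  /-- total number of steps so far -/
  steps : ℕ
  /-- for every insertion of a node into `R` so far (every attached set created), its number of
  steps; a record for the analysis only -/
  insertLog : List ℕ

def Detector.init : Detector where
  sp := Forest.empty
  isS := fun _ => false
  nsp := Forest.empty
  att := fun _ => none
  attPred := fun _ => 0
  attSucc := fun _ => none
  rSize := 0
  reach := fun _ _ => false
  futCount := 0
  futLast := fun _ => 0
  lastWriter := fun _ => none
  readers := fun _ => []
  races := []
  steps := 0
  insertLog := []

abbrev DetM (β : Type) : Type := StateM Detector β

def tick (c : ℕ) : DetM Unit := modify fun s => { s with steps := s.steps + c }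

/-! #### Disjoint-set operations -/

def findSP (x : ℕ) : DetM ℕ := do
  let s ← get
  let f := s.sp.find x
  set { s with sp := f.2.1, steps := s.steps + f.2.2 }
  return f.1

def findNSP (x : ℕ) : DetM ℕ := do
  let s ← get
  let f := s.nsp.find x
  set { s with nsp := f.2.1, steps := s.steps + f.2.2 }
  return f.1

/-- Allocate a strand: a singleton `S`-bag in `D_SP` and a singleton unattached set in `D_NSP`. -/
def newStrand : DetM ℕ := do
  tick 10
  let s ← get
  let x := s.nsp.size
  set { s with
    sp := s.sp.makeSet
    nsp := s.nsp.makeSet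
    isS := Function.update s.isS x true
    att := Function.update s.att x none
    attPred := Function.update s.attPred x 0
    attSucc := Function.update s.attSucc x none }
  return x

/-- Union in `D_SP`; the result is an `S`-bag. -/
def unionSP (x y : ℕ) : DetM Unit := do
  tick 1
  let s ← get
  let u := s.sp.union x y
  set { s with sp := u.2.1, isS := Function.update s.isS u.1 true, steps := s.steps + u.2.2 }

/-- The bag that contains strand `x` becomes a `P`-bag. -/
def toP (x : ℕ) : DetM Unit := do
  tick 1
  let r ← findSP x
  modify fun s => { s with isS := Function.update s.isS r false }

/-- Union in `D_NSP`: the set of `y` is merged into the set of `x`, whose status (attached or not,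
attached predecessor and successor) is kept. -/
def unionNSP (x y : ℕ) : DetM Unit := do
  tick 6
  let a ← findNSP x
  let s ← get
  let u := s.nsp.union x y
  set { s with
    nsp := u.2.1
    att := Function.update s.att u.1 (s.att a)
    attPred := Function.update s.attPred u.1 (s.attPred a)
    attSucc := Function.update s.attSucc u.1 (s.attSucc a)
    steps := s.steps + u.2.2 }

/-- The node of `R` of the set of `x` if this set is attached, `none` otherwise. -/
def attachedSet (x : ℕ) : DetM (Option ℕ) := do
  tick 1
  let r ← findNSP x
  return (← get).att r

/-- The set of `x` itself if it is attached, otherwise its attached predecessor. -/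
def predProxy (x : ℕ) : DetM ℕ := do
  tick 2
  let r ← findNSP x
  let s ← get
  return (s.att r).getD (s.attPred r)

/-- The set of `x` itself if it is attached, otherwise its attached successor, if it has one. -/
def succProxy (x : ℕ) : DetM (Option ℕ) := do
  tick 2
  let r ← findNSP x
  let s ← get
  return (s.att r).or (s.attSucc r)

def setAttPred (x a : ℕ) : DetM Unit := do
  tick 1
  let r ← findNSP x
  modify fun s => { s with attPred := Function.update s.attPred r a }

def setAttSucc (x a : ℕ) : DetM Unit := do
  tick 1
  let r ← findNSP x
  modify fun s => { s with attSucc := Function.update s.attSucc r (some a) }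

def setAttached (x a : ℕ) : DetM Unit := do
  tick 1
  let r ← findNSP x
  modify fun s => { s with att := Function.update s.att r (some a) }

/-! #### The reachability structure `R` -/

def readR (a b : ℕ) : DetM Bool := do
  tick 1
  return (← get).reach a b

def writeR (a b : ℕ) (v : Bool) : DetM Unit := do
  tick 1
  modify fun s => { s with reach := Function.update s.reach a (Function.update (s.reach a) b v) }

/-- Does node `y` equal or reach one of the given nodes? -/
def reachesAny (y : ℕ) : List ℕ → DetM Bool
  | [] => pure false
  | p :: ps => do
    let b ← readR y p
    let c ← reachesAny y ps
    return (y == p || b || c)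

/-- Is node `y` equal to or reached from one of the given nodes? -/
def reachedFromAny (y : ℕ) : List ℕ → DetM Bool
  | [] => pure false
  | q :: qs => do
    let b ← readR q y
    let c ← reachedFromAny y qs
    return (y == q || b || c)

/-- Fill in the column and the row of node `x` of the reachability matrix at the nodes below the
given bound. -/
def fillR (x : ℕ) (preds succs : List ℕ) : ℕ → DetM Unit
  | 0 => pure ()
  | y + 1 => do
    let b ← reachesAny y preds
    writeR y x b
    let c ← reachedFromAny y succs
    writeR x y c
    fillR x preds succs y

/-- Insert a new node into `R`, with an arc from every node of `preds` and an arc to every node of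
`succs`. -/
def insertR (preds succs : List ℕ) : DetM ℕ := do
  let s₀ ← get
  let x := s₀.rSize
  tick 2
  fillR x preds succs x
  writeR x x false
  modify fun s => { s with
    rSize := x + 1
    insertLog := (s.steps - s₀.steps) :: s.insertLog }
  return x

/-- Attachify: unless it is attached already, the set of `x` becomes an attached set, with an arc
from its attached predecessor and arcs to `succs`.  The result is its node of `R`. -/
def attachify (x : ℕ) (succs : List ℕ) : DetM ℕ := do
  match ← attachedSet x with
  | some a => return a
  | none =>
    let p ← predProxy x
    let a ← insertR [p] succs
    setAttached x a
    return a

/-- The new strand `x` becomes an attached set of its own, with arcs from `preds`. -/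
def attachNew (x : ℕ) (preds : List ℕ) : DetM Unit := do
  let a ← insertR preds []
  setAttached x a

/-! #### Parallel control -/

/-- A spawn that has not been joined yet: the strand that ends with it, the first strand of the
child, the first strand of the continuation, and the last strand of the child. -/
structure Pending where
  fork : ℕ
  child : ℕ
  cont : ℕ
  childEnd : ℕ

/-- Strand `f`, of the function instance whose first strand is `first`, ends with a `spawn`.
Returns the first strands of the child and of the continuation. -/
def onSpawn (first f : ℕ) : DetM (ℕ × ℕ) := do
  let v ← newStrand
  let w ← newStrand
  unionSP first w
  let a ← predProxy f
  setAttPred v a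
  setAttPred w a
  return (v, w)

/-- Strand `u` ends with a `create`.  Returns the first strands of the future and of the
continuation. -/
def onCreate (first u : ℕ) : DetM (ℕ × ℕ) := do
  let v ← newStrand
  let w ← newStrand
  unionSP first w
  let a ← attachify u []
  attachNew v [a]
  attachNew w [a]
  return (v, w)

/-- Strand `u` ends with a `get` of future `i`.  Returns the strand that follows. -/
def onGet (first u i : ℕ) : DetM ℕ := do
  let w ← newStrand
  unionSP first w
  let a ← attachify u []
  tick 1
  let t := (← get).futLast i
  let b ← attachedSet t
  attachNew w (a :: b.toList)
  return w

/-- Join one spawned child with strand `t` of its parent.  Returns the join strand. -/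
def joinOne (first t : ℕ) (J : Pending) : DetM ℕ := do
  tick 1
  let j ← newStrand
  unionSP first J.child
  unionSP first j
  let a₁ ← attachedSet J.childEnd
  let a₂ ← attachedSet t
  match a₁, a₂ with
  | none, none =>
    unionNSP J.fork J.childEnd
    unionNSP J.fork t
    unionNSP J.fork j
  | some a₁, some a₂ =>
    let c₁ ← attachedSet J.child
    let c₂ ← attachedSet J.cont
    let _ ← attachify J.fork (c₁.toList ++ c₂.toList)
    attachNew j [a₁, a₂]
  | some a₁, none =>
    if (← attachedSet J.fork).isNone then unionNSP J.child J.fork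
    unionNSP J.childEnd j
    setAttSucc t a₁
  | none, some a₂ =>
    if (← attachedSet J.fork).isNone then unionNSP J.cont J.fork
    unionNSP t j
    setAttSucc J.childEnd a₂
  return j

/-- `sync`: join all outstanding children, the most recent one first.  Returns the strand that
follows. -/
def onSync (first t : ℕ) : List Pending → DetM ℕ
  | [] => pure t
  | J :: js => do
    let j ← joinOne first t J
    onSync first j js

def newFuture : DetM ℕ := do
  tick 1
  let s ← get
  set { s with futCount := s.futCount + 1 }
  return s.futCount

def finishFuture (i t : ℕ) : DetM Unit := do
  tick 1
  modify fun s => { s with futLast := Function.update s.futLast i t }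

/-! #### Memory accesses -/

/-- Does the earlier strand `u` precede the currently executing strand `v`? -/
def query (u v : ℕ) : DetM Bool := do
  tick 1
  let r ← findSP u
  if (← get).isS r then return true
  match ← succProxy u with
  | none => return false
  | some a =>
    let b ← predProxy v
    readR a b

/-- Query strand `u` against the current strand `v`, and report a race on `l` if they are
parallel. -/
def checkRace (l u v : ℕ) : DetM Unit := do
  if !(← query u v) then
    tick 1
    modify fun s => { s with races := (l, u, v) :: s.races }

def checkAll (l v : ℕ) : List ℕ → DetM Unit
  | [] => pure ()
  | u :: us => do
    tick 1
    checkRace l u v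
    checkAll l v us

def onRead (l v : ℕ) : DetM Unit := do
  tick 2
  checkAll l v ((← get).lastWriter l).toList
  modify fun s => { s with readers := Function.update s.readers l (v :: s.readers l) }

def onWrite (l v : ℕ) : DetM Unit := do
  tick 4
  checkAll l v ((← get).lastWriter l).toList
  checkAll l v ((← get).readers l)
  modify fun s => { s with
    lastWriter := Function.update s.lastWriter l (some v)
    readers := Function.update s.readers l [] }

/-! #### The run -/

/-- Depth-first eager execution under the detector.  `first` is the first strand of the current
function instance, `cur` the currently executing strand, and `pend` holds the outstanding children,
the most recent one first.  Returns the last strand. -/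
def exec : Code → (first cur : ℕ) → List Pending → DetM ℕ
  | .ret, first, cur, pend => do
    tick 1
    onSync first cur pend
  | .compute rest, first, cur, pend => do
    tick 1
    exec rest first cur pend
  | .read l rest, first, cur, pend => do
    tick 1
    onRead l cur
    exec rest first cur pend
  | .write l rest, first, cur, pend => do
    tick 1
    onWrite l cur
    exec rest first cur pend
  | .call body rest, first, cur, pend => do
    tick 1
    let t ← exec body first cur []
    exec rest first t pend
  | .spawn body rest, first, cur, pend => do
    tick 1
    let (v, w) ← onSpawn first cur
    let t ← exec body v v []
    toP v
    exec rest first w (⟨cur, v, w, t⟩ :: pend)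
  | .create body rest, first, cur, pend => do
    tick 1
    let (v, w) ← onCreate first cur
    let i ← newFuture
    let t ← exec body v v []
    toP v
    finishFuture i t
    exec rest first w pend
  | .get i rest, first, cur, pend => do
    tick 1
    let w ← onGet first cur i
    exec rest first w pend
  | .sync rest, first, cur, pend => do
    tick 1
    let j ← onSync first cur pend
    exec rest first j []

/-- The final state of MultiBags+ on a program.  The first strand forms an attached set. -/
def multiBagsPlus (p : Code) : Detector :=
  let run : DetM Unit := do
    let x ← newStrand
    attachNew x []
    let _ ← exec p x x []
    toP x
  (run.run Detector.init).2

end FutureRace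

/-! Every operation of the detector is charged a constant number of units of `i + 1` steps, for a
level `i` of the Ackermann hierarchy.  A path compression is paid for by the potential of the
forests: an element of rank `r` whose parent has rank `q` holds, for every level up to `i`, one
credit for each iterate of `ack` started at `r` that `q` has not reached yet.  All elements but
`i + 1` of a compressed path lose a credit, as the next element of the same level above them pushes
their new parent past another iterate.  The query of a write about an earlier read is prepaid by
that read.  Insertions into `R` are charged to future operations: only these make strands of
unattached sets attached, and a join of two attached branches, which inserts two nodes, leaves one
attached strand in place of two.  Finally, `i` is taken to be `α(m, n)`, with the iterates of the
top level followed up to `ack i (m / n + 2)`, unless there are more future operations than forks;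
then `i = 1`, and the strands are paid for by `k ^ 2`. -/

namespace FutureRace

/-! ### The Ackermann hierarchy as a potential -/

theorem add_le_iterate {f : ℕ → ℕ} (hf : ∀ r, r < f r) (r j : ℕ) : r + j ≤ f^[j] r := by
  induction j with
  | zero => rfl
  | succ j ih =>
    rw [Function.iterate_succ_apply']
    have := hf (f^[j] r)
    omega

theorem ack_succ_eq_iterate (k r : ℕ) : ack (k + 1) r = (ack k)^[r + 1] 1 := by
  induction r with
  | zero => simp
  | succ r ih => rw [ack_succ_succ, ih, Function.iterate_succ_apply' _ (r + 1)]

theorem ack_succ_le_iterate (k r : ℕ) : ack (k + 1) r ≤ (ack k)^[r + 2] r := by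
  rw [ack_succ_eq_iterate, Function.iterate_succ_apply (ack k) (r + 1)]
  exact (ack_mono_right k).iterate (r + 1) (ack_pos k r)

theorem exists_ack_level (i : ℕ) {r q : ℕ} (h : r < q) :
    ∃ k ≤ i, ack k r ≤ q ∧ (k < i → q < ack (k + 1) r) := by
  refine ⟨Nat.findGreatest (ack · r ≤ q) i, Nat.findGreatest_le i,
    Nat.findGreatest_spec (P := (ack · r ≤ q)) (Nat.zero_le i) (by rw [ack_zero]; exact h),
    fun hlt => ?_⟩
  exact not_le.mp (Nat.findGreatest_is_greatest (P := (ack · r ≤ q)) (lt_add_one _) hlt)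

/-- How far `q` lags behind the first `c` iterates of `f` started at `r`: the number of those that
it has not reached yet. -/
def lag (f : ℕ → ℕ) (c r q : ℕ) : ℕ := {j ∈ Finset.range c | q < f^[j + 1] r}.card

theorem lag_antitone (f : ℕ → ℕ) (c r : ℕ) : Antitone (lag f c r) := fun q q' h => by
  unfold lag
  gcongr

theorem lag_zero {f : ℕ → ℕ} (hf : ∀ r, r < f r) (c r : ℕ) : lag f c r 0 = c := by
  have h : ∀ j ∈ Finset.range c, 0 < f^[j + 1] r := fun j _ => by
    have := add_le_iterate hf r (j + 1)
    omega
  rw [lag, Finset.filter_true_of_mem h, Finset.card_range]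

theorem lag_lt {f : ℕ → ℕ} (hf : Monotone f) {c r q q' : ℕ} (hrq : f r ≤ q)
    (hc : q < f^[c + 1] r) (hq : q ≤ q') (hq' : f q ≤ q') :
    lag f (c + 1) r q' < lag f (c + 1) r q := by
  classical
  obtain ⟨j, hj, hmin⟩ : ∃ j, q < f^[j + 1] r ∧ ∀ i < j, f^[i + 1] r ≤ q :=
    have hex : ∃ j, q < f^[j + 1] r := ⟨c, hc⟩
    ⟨Nat.find hex, Nat.find_spec hex, fun i hi => not_lt.mp (Nat.find_min hex hi)⟩
  have hjc : j ≤ c := not_lt.mp fun h => hc.not_ge (hmin c h)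
  have hjq : f^[j + 1] r ≤ q' := by
    cases j with
    | zero => exact hrq.trans hq
    | succ j =>
      rw [Function.iterate_succ_apply']
      exact (hf (hmin j (lt_add_one j))).trans hq'
  refine Finset.card_lt_card (Finset.ssubset_iff_of_subset
    (Finset.monotone_filter_right _ fun _ _ h => hq.trans_lt h) |>.2 ⟨j, ?_, ?_⟩)
  · exact Finset.mem_filter.2 ⟨Finset.mem_range.2 (by omega), hj⟩
  · exact fun h => (Finset.mem_filter.1 h).2.not_ge hjq

/-- The potential of an element of rank `r` whose parent has rank `q`: the lag of `q` behind the
iterates of `ack k`, summed over the levels `k ≤ i`.  Below level `i` it is enough to follow the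
iterates up to `ack (k + 1) r`; at level `i` they are followed up to `ack i (d + 1)`, which has to
bound all ranks. -/
def slack (i d r q : ℕ) : ℕ :=
  ∑ k ∈ Finset.range i, lag (ack k) (r + 2) r q + lag (ack i) (d + 2) r q

theorem slack_antitone (i d r : ℕ) : Antitone (slack i d r) := fun _ _ h =>
  add_le_add (Finset.sum_le_sum fun _ _ => lag_antitone _ _ _ h) (lag_antitone _ _ _ h)

theorem slack_zero (i d r : ℕ) : slack i d r 0 = i * (r + 2) + (d + 2) := by
  simp only [slack, lag_zero (lt_ack_right _), Finset.sum_const, Finset.card_range, smul_eq_mul]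

theorem slack_lt {i d r q q' k : ℕ} (hk : k ≤ i) (hrq : ack k r ≤ q)
    (hmax : k < i → q < ack (k + 1) r) (hq : ack k q ≤ q') (hd : q' ≤ ack i (d + 1)) :
    slack i d r q' < slack i d r q := by
  have hqq : q ≤ q' := (lt_ack_right k q).le.trans hq
  have hlag : ∀ k c, lag (ack k) c r q' ≤ lag (ack k) c r q := fun k c => lag_antitone _ _ _ hqq
  rcases hk.lt_or_eq with hk | rfl
  · refine add_lt_add_of_lt_of_le (Finset.sum_lt_sum (fun k _ => hlag k _)
      ⟨k, Finset.mem_range.2 hk, ?_⟩) (hlag i _)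
    exact lag_lt (ack_mono_right k) hrq ((hmax hk).trans_le (ack_succ_le_iterate k r)) hqq hq
  · refine add_lt_add_of_le_of_lt (Finset.sum_le_sum fun k _ => hlag k _)
      (lag_lt (ack_mono_right k) hrq ?_ hqq hq)
    rw [Function.iterate_succ_apply']
    have := add_le_iterate (lt_ack_right k) r (d + 1)
    calc q < ack k q := lt_ack_right k q
      _ ≤ ack k (d + 1) := hq.trans hd
      _ ≤ ack k ((ack k)^[d + 1] r) := ack_mono_right k (by omega)

/-! ### Amortised analysis of disjoint-set forests -/

namespace Forest

variable {d e : Forest} {x y : ℕ}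

/-- The number of elements that a tree whose root is `x` must have according to its rank. -/
def rootWeight (d : Forest) (x : ℕ) : ℕ := if d.parent x = x then 2 ^ d.rank x else 0

/-- The invariants of union by rank. -/
structure Wf (d : Forest) : Prop where
  lt_size : ∀ x, d.parent x ≠ x → x < d.size ∧ d.parent x < d.size
  rank_lt : ∀ x, d.parent x ≠ x → d.rank x < d.rank (d.parent x)
  pow_rank_le : ∀ x < d.size, 2 ^ d.rank x ≤ d.size
  sum_rootWeight_le : ∑ x ∈ Finset.range d.size, d.rootWeight x ≤ d.size

/-- The representative of the set of `x`. -/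
def root (d : Forest) (x : ℕ) : ℕ := d.parent^[d.size] x

theorem root_eq_self (h : d.parent x = x) : d.root x = x := Function.iterate_fixed h _

theorem findAux_fst (d : Forest) (n x : ℕ) : (d.findAux n x).1 = d.parent^[n] x := by
  induction n generalizing x with
  | zero => rfl
  | succ n ih =>
    simp only [findAux]
    split_ifs with h
    · exact (Function.iterate_fixed h _).symm
    · exact ih _

theorem find_fst (d : Forest) (x : ℕ) : (d.find x).1 = d.root x := findAux_fst d _ x

namespace Wf

theorem rank_lt_size (h : d.Wf) (hx : x < d.size) : d.rank x < d.size :=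
  Nat.lt_two_pow_self.trans_le (h.pow_rank_le x hx)

theorem parent_eq_self (h : d.Wf) (hx : d.size ≤ x) : d.parent x = x :=
  not_not.mp fun hp => (h.lt_size x hp).1.not_ge hx

theorem parent_lt (h : d.Wf) (hx : x < d.size) : d.parent x < d.size := by
  by_cases hp : d.parent x = x
  · rwa [hp]
  · exact (h.lt_size x hp).2

theorem rank_le_rank_parent (h : d.Wf) (x : ℕ) : d.rank x ≤ d.rank (d.parent x) := by
  by_cases hp : d.parent x = x
  · rw [hp]
  · exact (h.rank_lt x hp).le

theorem rank_le_rank_root (h : d.Wf) (x : ℕ) : d.rank x ≤ d.rank (d.root x) := by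
  have key : ∀ n, d.rank x ≤ d.rank (d.parent^[n] x) := fun n => by
    induction n with
    | zero => rfl
    | succ n ih =>
      rw [Function.iterate_succ_apply']
      exact ih.trans (h.rank_le_rank_parent _)
  exact key _

theorem root_lt (h : d.Wf) (hx : x < d.size) : d.root x < d.size :=
  Set.MapsTo.iterate (s := Set.Iio d.size) (fun _ => h.parent_lt) d.size hx

theorem parent_iterate (h : d.Wf) {n : ℕ} (hn : d.size ≤ n + d.rank x) :
    d.parent (d.parent^[n] x) = d.parent^[n] x := by
  induction n generalizing x with
  | zero =>
    refine not_not.mp fun hp => ?_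
    have := h.rank_lt_size (h.lt_size x hp).1
    omega
  | succ n ih =>
    by_cases hp : d.parent x = x
    · rwa [Function.iterate_fixed hp]
    · have := h.rank_lt x hp
      exact ih (by omega)

theorem parent_root (h : d.Wf) (x : ℕ) : d.parent (d.root x) = d.root x :=
  h.parent_iterate (by omega)

theorem root_eq_of_invariant (h : d.Wf) {f : ℕ → ℕ} (hf : ∀ x, f (d.parent x) = f x)
    (hr : ∀ x, d.parent x = x → f x = x) (x : ℕ) : d.root x = f x := by
  have hfx : f (d.root x) = f x :=
    congrFun (Function.iterate_invariant (funext hf) d.size) x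
  rw [← hfx, hr _ (h.parent_root x)]

theorem root_parent (h : d.Wf) (x : ℕ) : d.root (d.parent x) = d.root x := by
  rw [root, ← Function.iterate_succ_apply, Function.iterate_succ_apply']
  exact h.parent_root x

theorem root_root (h : d.Wf) (x : ℕ) : d.root (d.root x) = d.root x :=
  root_eq_self (h.parent_root x)

theorem root_ne_self (h : d.Wf) (hx : d.parent x ≠ x) : d.root x ≠ x := fun hr =>
  hx (by simpa only [hr] using h.parent_root x)

theorem parent_iterate_eq_root (h : d.Wf) {n : ℕ} (hn : d.size ≤ n + d.rank x) :
    d.parent^[n] x = d.root x := by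
  have hroot : d.root (d.parent^[n] x) = d.root x :=
    congrFun (Function.iterate_invariant (funext h.root_parent) n) x
  rw [← hroot, root_eq_self (h.parent_iterate hn)]

end Wf

/-- The rank of the parent of a non-root, and `0` for a root, so that a root has the full slack. -/
def upRank (d : Forest) (x : ℕ) : ℕ := if d.parent x = x then 0 else d.rank (d.parent x)

/-- The potential of a forest, which pays for the compression of long paths. -/
def potential (i b : ℕ) (d : Forest) : ℕ :=
  ∑ x ∈ Finset.range d.size, slack i b (d.rank x) (d.upRank x)

theorem potential_redirect {a : ℕ} (hx : x < d.size) (hp : d.parent x ≠ x) (ha : a ≠ x)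
    (i b : ℕ) :
    potential i b { d with parent := Function.update d.parent x a } +
        slack i b (d.rank x) (d.rank (d.parent x)) =
      d.potential i b + slack i b (d.rank x) (d.rank a) := by
  have hx := Finset.mem_range.2 hx
  have hterm : (fun y => slack i b (d.rank y)
      (upRank { d with parent := Function.update d.parent x a } y)) =
      Function.update (fun y => slack i b (d.rank y) (d.upRank y)) x
        (slack i b (d.rank x) (d.rank a)) := by
    funext y
    by_cases hy : y = x
    · subst hy
      simp [upRank, ha]
    · simp [upRank, hy]
  simp only [potential, hterm, Finset.sum_update_of_mem hx]
  rw [Finset.sum_eq_add_sum_sdiff_singleton_of_mem hx, upRank, if_neg hp]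
  omega

/-- `e` arises from `d` by linking some elements directly to their representatives. -/
structure Compressed (d e : Forest) : Prop where
  size_eq : e.size = d.size
  rank_eq : e.rank = d.rank
  parent_eq : ∀ x, e.parent x = d.parent x ∨ e.parent x = d.root x

namespace Compressed

theorem refl (d : Forest) : Compressed d d := ⟨rfl, rfl, fun _ => .inl rfl⟩

theorem parent_eq_self_iff (h : Compressed d e) (hd : d.Wf) :
    e.parent x = x ↔ d.parent x = x := by
  rcases h.parent_eq x with hx | hx <;> rw [hx]
  exact ⟨fun hr => not_not.mp fun hp => hd.root_ne_self hp hr, root_eq_self⟩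

theorem redirect (h : Compressed d e) (x : ℕ) :
    Compressed d { e with parent := Function.update e.parent x (d.root x) } := by
  refine ⟨h.size_eq, h.rank_eq, fun y => ?_⟩
  by_cases hy : y = x
  · exact .inr (by simp only [hy, Function.update_self])
  · simpa only [Function.update_of_ne hy] using h.parent_eq y

theorem wf (h : Compressed d e) (hd : d.Wf) : e.Wf where
  lt_size x hx := by
    have hlt := hd.lt_size x (mt (h.parent_eq_self_iff hd).2 hx)
    rw [h.size_eq]
    refine ⟨hlt.1, ?_⟩
    rcases h.parent_eq x with hp | hp <;> rw [hp]
    exacts [hlt.2, hd.root_lt hlt.1]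
  rank_lt x hx := by
    have hlt := hd.rank_lt x (mt (h.parent_eq_self_iff hd).2 hx)
    rw [h.rank_eq]
    rcases h.parent_eq x with hp | hp <;> rw [hp]
    · exact hlt
    · rw [← hd.root_parent]
      exact hlt.trans_le (hd.rank_le_rank_root _)
  pow_rank_le := by
    rw [h.size_eq, h.rank_eq]
    exact hd.pow_rank_le
  sum_rootWeight_le := by
    simp only [rootWeight, h.size_eq, h.rank_eq, h.parent_eq_self_iff hd]
    exact hd.sum_rootWeight_le

theorem root_eq (h : Compressed d e) (hd : d.Wf) (x : ℕ) : e.root x = d.root x := by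
  refine (h.wf hd).root_eq_of_invariant (fun x => ?_)
    (fun x hx => root_eq_self ((h.parent_eq_self_iff hd).1 hx)) x
  rcases h.parent_eq x with hp | hp <;> rw [hp]
  exacts [hd.root_parent x, hd.root_root x]

theorem trans {f : Forest} (h : Compressed d e) (h' : Compressed e f) (hd : d.Wf) :
    Compressed d f := by
  refine ⟨h'.size_eq.trans h.size_eq, h'.rank_eq.trans h.rank_eq, fun x => ?_⟩
  rcases h'.parent_eq x with hx | hx <;> rw [hx]
  exacts [h.parent_eq x, .inr (h.root_eq hd x)]

end Compressed

theorem findAux_compressed (hd : d.Wf) {n : ℕ} (hn : d.size ≤ n + d.rank x) :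
    Compressed d (d.findAux n x).2.1 := by
  induction n generalizing x with
  | zero => exact .refl d
  | succ n ih =>
    simp only [findAux]
    split_ifs with hp
    · exact .refl d
    · have hlt := hd.rank_lt x hp
      rw [findAux_fst, hd.parent_iterate_eq_root (by omega), hd.root_parent]
      exact (ih (by omega)).redirect x

theorem findAux_parent_of_rank_lt (hd : d.Wf) (n : ℕ) {z : ℕ} (hz : d.rank z < d.rank x) :
    (d.findAux n x).2.1.parent z = d.parent z := by
  induction n generalizing x with
  | zero => rfl
  | succ n ih =>
    simp only [findAux]
    split_ifs with hp
    · rfl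
    · have hzx : z ≠ x := by
        rintro rfl
        exact hz.false
      exact (Function.update_of_ne hzx _ _).trans (ih (hz.trans (hd.rank_lt x hp)))

/-- The level of an element is the largest `k ≤ i` for which `ack k` of its rank is at most the rank
of its parent.  An element is charged for its level if this level does not occur further up its
path, which happens once per level: these levels form the set `S`.  All other elements lose
potential. -/
theorem findAux_steps_le (hd : d.Wf) {i b : ℕ} (hR : ∀ x < d.size, d.rank x ≤ ack i (b + 1))
    {n : ℕ} (hn : d.size ≤ n + d.rank x) :
    ∃ S ⊆ Finset.range (i + 1), (∀ k ∈ S, ack k (d.rank x) ≤ d.rank (d.root x)) ∧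
      (d.findAux n x).2.2 + 2 * (d.findAux n x).2.1.potential i b ≤
        1 + 2 * d.potential i b + 2 * S.card := by
  induction n generalizing x with
  | zero => exact ⟨∅, by simp, by simp, by simp [findAux]⟩
  | succ n ih =>
    by_cases hp : d.parent x = x
    · exact ⟨∅, by simp, by simp, by simp [findAux, hp]⟩
    have hlt := hd.rank_lt x hp
    have hn' : d.size ≤ n + d.rank (d.parent x) := by omega
    have hx := (hd.lt_size x hp).1
    have hc := findAux_compressed hd hn'
    have hpx := findAux_parent_of_rank_lt hd n hlt
    have hle : d.rank (d.parent x) ≤ d.rank (d.root x) :=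
      hd.root_parent x ▸ hd.rank_le_rank_root _
    obtain ⟨S, hS, hSr, hsteps⟩ := ih hn'
    have hpot := potential_redirect (d := (d.findAux n (d.parent x)).2.1) (hc.size_eq ▸ hx)
      (by rwa [hpx]) (hd.root_ne_self hp) i b
    rw [hpx, hc.rank_eq] at hpot
    rw [hd.root_parent] at hSr
    simp only [findAux, if_neg hp]
    rw [findAux_fst, hd.parent_iterate_eq_root hn', hd.root_parent, hc.rank_eq]
    obtain ⟨k, hki, hk, hk'⟩ := exists_ack_level i hlt
    have hS' : ∀ k ∈ S, ack k (d.rank x) ≤ d.rank (d.root x) := fun k hk =>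
      (ack_mono_right k hlt.le).trans (hSr k hk)
    by_cases hkS : k ∈ S
    · refine ⟨S, hS, hS', ?_⟩
      have := slack_lt hki hk hk' (hSr k hkS) (hR _ (hd.root_lt hx))
      omega
    · refine ⟨insert k S, Finset.insert_subset (Finset.mem_range_succ_iff.2 hki) hS,
        Finset.forall_mem_insert .. |>.2 ⟨hk.trans hle, hS'⟩, ?_⟩
      have := slack_antitone i b (d.rank x) hle
      rw [Finset.card_insert_of_notMem hkS]
      omega

theorem find_compressed (hd : d.Wf) (x : ℕ) : Compressed d (d.find x).2.1 :=
  findAux_compressed hd (by omega)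

theorem find_steps_le (hd : d.Wf) {i b : ℕ} (hR : ∀ x < d.size, d.rank x ≤ ack i (b + 1))
    (x : ℕ) :
    (d.find x).2.2 + 2 * (d.find x).2.1.potential i b ≤ 2 * d.potential i b + 3 * (i + 1) := by
  obtain ⟨S, hS, -, h⟩ := findAux_steps_le hd hR (x := x) (n := d.size) (by omega)
  have := Finset.card_le_card hS
  rw [Finset.card_range] at this
  rw [find]
  omega

theorem empty_wf : Forest.empty.Wf := by
  constructor <;> simp [empty]

theorem potential_empty (i b : ℕ) : Forest.empty.potential i b = 0 := by
  simp [potential, empty]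

theorem makeSet_wf (h : d.Wf) : d.makeSet.Wf where
  lt_size x hx := by
    by_cases hxs : x = d.size
    · simp [makeSet, hxs] at hx
    · simp only [makeSet, Function.update_of_ne hxs] at hx ⊢
      have := h.lt_size x hx
      omega
  rank_lt x hx := by
    by_cases hxs : x = d.size
    · simp [makeSet, hxs] at hx
    · simp only [makeSet, Function.update_of_ne hxs] at hx ⊢
      rw [Function.update_of_ne (h.lt_size x hx).2.ne]
      exact h.rank_lt x hx
  pow_rank_le x hx := by
    by_cases hxs : x = d.size
    · simp [makeSet, hxs]
    · simp only [makeSet, Function.update_of_ne hxs] at hx ⊢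
      have := h.pow_rank_le x (by omega)
      omega
  sum_rootWeight_le := by
    have hold : ∀ x ∈ Finset.range d.size, d.makeSet.rootWeight x = d.rootWeight x :=
      fun x hx => by simp [rootWeight, makeSet, (Finset.mem_range.1 hx).ne]
    have hnew : d.makeSet.rootWeight d.size = 1 := by simp [rootWeight, makeSet]
    rw [show d.makeSet.size = d.size + 1 from rfl, Finset.sum_range_succ,
      Finset.sum_congr rfl hold, hnew]
    exact Nat.add_le_add_right h.sum_rootWeight_le 1

theorem makeSet_root (h : d.Wf) (x : ℕ) : d.makeSet.root x = d.root x := by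
  have hsize := h.parent_eq_self le_rfl
  have hparent : d.makeSet.parent = d.parent := by
    simp only [makeSet]
    rw [Function.update_eq_self_iff, hsize]
  refine (makeSet_wf h).root_eq_of_invariant (fun x => ?_) (fun x hx => ?_) x
  · rw [hparent, h.root_parent]
  · exact root_eq_self (hparent ▸ hx)

theorem makeSet_potential (h : d.Wf) (i b : ℕ) :
    d.makeSet.potential i b = d.potential i b + (2 * i + b + 2) := by
  have hold : ∀ x ∈ Finset.range d.size,
      slack i b (d.makeSet.rank x) (d.makeSet.upRank x) = slack i b (d.rank x) (d.upRank x) := by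
    intro x hx
    have hx := Finset.mem_range.1 hx
    simp [makeSet, upRank, hx.ne, (h.parent_lt hx).ne]
  have hnew : slack i b (d.makeSet.rank d.size) (d.makeSet.upRank d.size) = 2 * i + b + 2 := by
    simp only [makeSet, upRank, Function.update_self, if_true, slack_zero]
    omega
  rw [potential, show d.makeSet.size = d.size + 1 from rfl, Finset.sum_range_succ,
    Finset.sum_congr rfl hold, hnew, potential]

/-- `e` arises from `d` by linking the root `y` to the root `x`. -/
structure Linked (d e : Forest) (x y : ℕ) : Prop where
  left_lt : x < d.size
  right_lt : y < d.size
  left_root : d.parent x = x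
  right_root : d.parent y = y
  ne : x ≠ y
  size_eq : e.size = d.size
  parent_eq : e.parent = Function.update d.parent y x
  rank_of_ne : ∀ z, z ≠ x → e.rank z = d.rank z
  rank_eq : e.rank x = d.rank x ∧ d.rank y < d.rank x ∨
    e.rank x = d.rank x + 1 ∧ d.rank y = d.rank x

namespace Linked

theorem rank_le (h : Linked d e x y) (z : ℕ) : d.rank z ≤ e.rank z := by
  by_cases hz : z = x
  · subst hz
    rcases h.rank_eq with h | h <;> omega
  · rw [h.rank_of_ne z hz]

theorem parent_of_ne (h : Linked d e x y) {z : ℕ} (hz : z ≠ y) : e.parent z = d.parent z := by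
  rw [h.parent_eq, Function.update_of_ne hz]

theorem parent_right (h : Linked d e x y) : e.parent y = x := by
  rw [h.parent_eq, Function.update_self]

theorem rootWeight_le (h : Linked d e x y) (z : ℕ) :
    e.rootWeight z + (if z = y then 2 ^ d.rank y else 0) ≤
      d.rootWeight z + if z = x then 2 ^ d.rank y else 0 := by
  by_cases hy : z = y
  · subst hy
    simp [rootWeight, h.parent_right, h.right_root, h.ne]
  by_cases hx : z = x
  · subst hx
    rcases h.rank_eq with ⟨h₁, -⟩ | ⟨h₁, h₂⟩
    · simp [rootWeight, h.parent_of_ne h.ne, h.left_root, h.ne, h₁]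
    · simp [rootWeight, h.parent_of_ne h.ne, h.left_root, h.ne, h₁, h₂, pow_succ, mul_two]
  · simp [rootWeight, h.parent_of_ne hy, h.rank_of_ne z hx, hx, hy]

theorem sum_rootWeight_le (h : Linked d e x y) (hd : d.Wf) :
    ∑ z ∈ Finset.range e.size, e.rootWeight z ≤ e.size := by
  have hsum := Finset.sum_le_sum fun z (_ : z ∈ Finset.range d.size) => h.rootWeight_le z
  simp only [Finset.sum_add_distrib, Finset.sum_ite_eq', Finset.mem_range, h.left_lt, h.right_lt,
    if_true] at hsum
  rw [h.size_eq]
  exact (Nat.le_of_add_le_add_right hsum).trans hd.sum_rootWeight_le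

theorem wf (h : Linked d e x y) (hd : d.Wf) : e.Wf where
  lt_size z hz := by
    rw [h.size_eq]
    by_cases hy : z = y
    · subst hy
      exact ⟨h.right_lt, h.parent_right ▸ h.left_lt⟩
    · rw [h.parent_of_ne hy] at hz ⊢
      exact hd.lt_size z hz
  rank_lt z hz := by
    by_cases hy : z = y
    · subst hy
      rw [h.parent_right, h.rank_of_ne z h.ne.symm]
      rcases h.rank_eq with h | h <;> omega
    · rw [h.parent_of_ne hy] at hz ⊢
      rw [h.rank_of_ne z (by rintro rfl; exact hz h.left_root)]
      exact (hd.rank_lt z hz).trans_le (h.rank_le _)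
  pow_rank_le z hz := by
    by_cases hx : z = x
    · subst hx
      have hroot : e.parent z = z := (h.parent_of_ne h.ne).trans h.left_root
      calc 2 ^ e.rank z = e.rootWeight z := (if_pos hroot).symm
        _ ≤ ∑ z ∈ Finset.range e.size, e.rootWeight z :=
          Finset.single_le_sum (fun _ _ => zero_le) (Finset.mem_range.2 hz)
        _ ≤ e.size := h.sum_rootWeight_le hd
    · rw [h.size_eq] at hz ⊢
      rw [h.rank_of_ne z hx]
      exact hd.pow_rank_le z hz
  sum_rootWeight_le := h.sum_rootWeight_le hd

theorem root_eq (h : Linked d e x y) (hd : d.Wf) (z : ℕ) :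
    e.root z = if d.root z = y then x else d.root z := by
  refine (h.wf hd).root_eq_of_invariant (f := fun z => if d.root z = y then x else d.root z)
    (fun z => ?_) (fun z hz => ?_) z
  · by_cases hy : z = y
    · subst hy
      simp only [h.parent_right, root_eq_self h.left_root, root_eq_self h.right_root, h.ne,
        if_true, if_false]
    · simp only [h.parent_of_ne hy, hd.root_parent]
  · have hy : z ≠ y := by
      rintro rfl
      exact h.ne (h.parent_right.symm.trans hz)
    simp only [root_eq_self (h.parent_of_ne hy ▸ hz), hy, if_false]

theorem slack_le (h : Linked d e x y) (i b z : ℕ) :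
    slack i b (e.rank z) (e.upRank z) ≤
      slack i b (d.rank z) (d.upRank z) + if z = x then i else 0 := by
  by_cases hx : z = x
  · subst hx
    simp only [upRank, h.parent_of_ne h.ne, h.left_root, if_true, slack_zero]
    rcases h.rank_eq with ⟨h, -⟩ | ⟨h, -⟩ <;> rw [h]
    · omega
    · rw [show d.rank z + 1 + 2 = d.rank z + 2 + 1 from rfl, mul_add_one]
      omega
  · rw [if_neg hx, h.rank_of_ne z hx, add_zero]
    apply slack_antitone
    by_cases hy : z = y
    · subst hy
      simp [upRank, h.right_root]
    · simp only [upRank, h.parent_of_ne hy]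
      split_ifs
      exacts [le_rfl, h.rank_le _]

theorem potential_le (h : Linked d e x y) (i b : ℕ) :
    e.potential i b ≤ d.potential i b + i := by
  calc e.potential i b
      ≤ ∑ z ∈ Finset.range d.size,
          (slack i b (d.rank z) (d.upRank z) + if z = x then i else 0) := by
        rw [potential, h.size_eq]
        exact Finset.sum_le_sum fun z _ => h.slack_le i b z
    _ = d.potential i b + i := by
        rw [Finset.sum_add_distrib, Finset.sum_ite_eq', if_pos (Finset.mem_range.2 h.left_lt),
          potential]

end Linked

theorem union_cases (hd : d.Wf) (hx : x < d.size) (hy : y < d.size) :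
    ∃ e, Compressed d e ∧
      (∀ i b, (∀ z < d.size, d.rank z ≤ ack i (b + 1)) →
        (d.union x y).2.2 + 2 * e.potential i b ≤ 2 * d.potential i b + 10 * (i + 1)) ∧
      ((d.union x y).1 = d.root x ∧ (d.union x y).2.1 = e ∧ d.root x = d.root y ∨
        (d.union x y).1 = d.root x ∧ Linked e (d.union x y).2.1 (d.root x) (d.root y) ∨
        (d.union x y).1 = d.root y ∧ Linked e (d.union x y).2.1 (d.root y) (d.root x)) := by
  have hcx := find_compressed hd x
  have hcy := find_compressed (hcx.wf hd) y
  have hc := hcx.trans hcy hd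
  have hsteps : (d.union x y).2.2 = (d.find x).2.2 + ((d.find x).2.1.find y).2.2 + 4 := by
    simp only [union]
    split_ifs <;> rfl
  refine ⟨_, hc, fun i b hR => ?_, ?_⟩
  · have h₁ := find_steps_le hd hR x
    have h₂ := find_steps_le (hcx.wf hd) (by rwa [hcx.size_eq, hcx.rank_eq]) y
    omega
  have hxr := hc.root_eq hd x ▸ (hc.wf hd).parent_root x
  have hyr := hc.root_eq hd y ▸ (hc.wf hd).parent_root y
  have hxs := hc.size_eq.symm ▸ hd.root_lt hx
  have hys := hc.size_eq.symm ▸ hd.root_lt hy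
  simp only [union, find_fst, hcx.root_eq hd y]
  generalize ((d.find x).2.1.find y).2.1 = e at *
  split_ifs with hxy hlt hgt
  · exact .inl ⟨rfl, rfl, hxy⟩
  · exact .inr (.inr ⟨rfl, hys, hxs, hyr, hxr, Ne.symm hxy, rfl, rfl, fun _ _ => rfl,
      .inl ⟨rfl, hlt⟩⟩)
  · exact .inr (.inl ⟨rfl, hxs, hys, hxr, hyr, hxy, rfl, rfl, fun _ _ => rfl, .inl ⟨rfl, hgt⟩⟩)
  · exact .inr (.inl ⟨rfl, hxs, hys, hxr, hyr, hxy, rfl, rfl,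
      fun z hz => Function.update_of_ne hz _ _,
      .inr ⟨Function.update_self _ _ _, le_antisymm (not_lt.mp hlt) (not_lt.mp hgt)⟩⟩)

/-- `e` arises from `d` by merging the sets of `x` and `y` into one with representative `c`. -/
structure Merged (d e : Forest) (x y c : ℕ) : Prop where
  wf : e.Wf
  size_eq : e.size = d.size
  root_eq : ∀ z, e.root z = if d.root z = d.root x ∨ d.root z = d.root y then c else d.root z
  rep : c = d.root x ∨ c = d.root y

theorem union_merged (hd : d.Wf) (hx : x < d.size) (hy : y < d.size) :
    Merged d (d.union x y).2.1 x y (d.union x y).1 := by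
  obtain ⟨e, hc, -, h⟩ := union_cases hd hx hy
  have he := hc.wf hd
  rcases h with ⟨hu, hue, hxy⟩ | ⟨hu, hl⟩ | ⟨hu, hl⟩ <;> rw [hu]
  · rw [hue]
    refine ⟨he, hc.size_eq, fun z => ?_, .inl rfl⟩
    rw [hc.root_eq hd]
    grind
  all_goals
    refine ⟨hl.wf he, hl.size_eq.trans hc.size_eq, fun z => ?_, by tauto⟩
    rw [hl.root_eq he, hc.root_eq hd]
    grind

theorem union_steps_le (hd : d.Wf) (hx : x < d.size) (hy : y < d.size) {i b : ℕ}
    (hR : ∀ z < d.size, d.rank z ≤ ack i (b + 1)) :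
    (d.union x y).2.2 + 2 * (d.union x y).2.1.potential i b ≤
      2 * d.potential i b + 12 * (i + 1) := by
  obtain ⟨e, -, hsteps, h⟩ := union_cases hd hx hy
  have := hsteps i b hR
  have : (d.union x y).2.1.potential i b ≤ e.potential i b + i := by
    rcases h with ⟨-, h, -⟩ | ⟨-, h⟩ | ⟨-, h⟩
    exacts [h ▸ Nat.le_add_right _ _, h.potential_le i b, h.potential_le i b]
  omega

end Forest

/-! ### Amortised cost of the detector -/

section Post

variable {α β : Type} {s : Detector} {m : DetM α} {Q : α → Detector → Prop}

/-- `Q` holds for the result and the final state of `m` run from `s`. -/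
def Post (m : DetM α) (s : Detector) (Q : α → Detector → Prop) : Prop := Q (m s).1 (m s).2

theorem Post.bind {f : α → DetM β} {R : β → Detector → Prop} (h : Post m s Q)
    (h' : ∀ a s', Q a s' → Post (f a) s' R) : Post (m >>= f) s R := h' _ _ h

theorem Post.mono {R : α → Detector → Prop} (h : Post m s Q) (h' : ∀ a s', Q a s' → R a s') :
    Post m s R := h' _ _ h

theorem Post.pure {a : α} (h : Q a s) : Post (Pure.pure a) s Q := h

theorem Post.get {f : Detector → DetM β} {R : β → Detector → Prop} (h : Post (f s) s R) :
    Post (get >>= f) s R := h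

theorem Post.modify {f : Detector → Detector} {R : PUnit → Detector → Prop} (h : R ⟨⟩ (f s)) :
    Post (modify f) s R := h

end Post

/-- Parameters of the analysis: level and base of the forest potential, and a bound on the number
of strands for which ranks stay in the range that the potential supports. -/
structure Params where
  level : ℕ
  base : ℕ
  strands : ℕ
  log_le : Nat.log 2 strands ≤ ack level (base + 1)

theorem Params.rank_le (P : Params) {d : Forest} (hd : d.Wf) (hN : d.size ≤ P.strands) :
    ∀ x < d.size, d.rank x ≤ ack P.level (P.base + 1) := fun x hx =>
  (Nat.le_log_of_pow_le one_lt_two ((hd.pow_rank_le x hx).trans hN)).trans P.log_le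

namespace Detector

/-- Is the set of strand `x` in `D_NSP` attached? -/
def attached (s : Detector) (x : ℕ) : Bool := (s.att (s.nsp.root x)).isSome

/-- The number of entries in the reader lists: the queries that later writes may have to make. -/
noncomputable def pendingReads (s : Detector) : ℕ := ∑ᶠ l, (s.readers l).length

/-- The representation invariant of the detector. -/
structure Wf (s : Detector) : Prop where
  sp_wf : s.sp.Wf
  nsp_wf : s.nsp.Wf
  size_eq : s.sp.size = s.nsp.size
  rSize_eq : s.rSize = s.insertLog.length
  insertLog_le : ∀ c ∈ s.insertLog, c ≤ 5 * s.insertLog.length + 3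
  finite_readers : {l | s.readers l ≠ []}.Finite

/-- The steps done so far and those prepaid for later, less the allowance for insertions into `R`
and for the allocation of strands. -/
noncomputable def balance (P : Params) (s : Detector) : ℤ :=
  s.steps + 2 * (s.sp.potential P.level P.base + s.nsp.potential P.level P.base) +
    17 * (P.level + 1) * s.pendingReads - s.insertLog.sum - 4 * P.base * s.nsp.size

/-- The part of the state on which the analysis depends. -/
def core (s : Detector) :
    Forest × Forest × (ℕ → Option ℕ) × ℕ × List ℕ × (ℕ → List ℕ) × ℕ :=
  (s.sp, s.nsp, s.att, s.rSize, s.insertLog, s.readers, s.steps)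

theorem attached_congr {s : Detector} {x y : ℕ} (h : s.nsp.root x = s.nsp.root y) :
    s.attached x = s.attached y := by
  rw [attached, h, attached]

theorem attached_update {s : Detector} {c : ℕ} {a : Option ℕ} {nsp : Forest} {x : ℕ} :
    {s with nsp := nsp, att := Function.update s.att c a}.attached x =
      if nsp.root x = c then a.isSome else (s.att (nsp.root x)).isSome := by
  simp only [attached, Function.update_apply]
  split_ifs <;> rfl

theorem pendingReads_update {s s' : Detector} (hs : s.Wf) {l : ℕ} {rs : List ℕ}
    (h : s'.readers = Function.update s.readers l rs) :
    s'.pendingReads + (s.readers l).length = s.pendingReads + rs.length := by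
  have hsupp : ∀ (r : ℕ → List ℕ), (∀ x ≠ l, r x = s.readers x) →
      Function.support (fun x => (r x).length) ⊆ ↑(insert l hs.finite_readers.toFinset) := by
    intro r hr x hx
    by_cases hxl : x = l
    · simp [hxl]
    · simpa [hxl, hr x hxl] using hx
  rw [pendingReads, pendingReads, h,
    finsum_eq_sum_of_support_subset _ (hsupp _ fun x hx => Function.update_of_ne hx _ _),
    finsum_eq_sum_of_support_subset _ (hsupp _ fun _ _ => rfl),
    ← Finset.add_sum_erase _ _ (Finset.mem_insert_self l _),
    ← Finset.add_sum_erase _ (fun x => (s.readers x).length) (Finset.mem_insert_self l _),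
    Function.update_self,
    Finset.sum_congr rfl fun x hx => by rw [Function.update_of_ne (Finset.ne_of_mem_erase hx)]]
  omega

theorem finite_readers_update {s : Detector} (hs : s.Wf) (l : ℕ) (rs : List ℕ) :
    {x | Function.update s.readers l rs x ≠ []}.Finite := by
  refine (hs.finite_readers.insert l).subset fun x hx => ?_
  by_cases hxl : x = l
  · exact .inl hxl
  · exact .inr (by simpa [hxl] using hx)

theorem init_wf : init.Wf where
  sp_wf := Forest.empty_wf
  nsp_wf := Forest.empty_wf
  size_eq := rfl
  rSize_eq := rfl
  insertLog_le := by simp [init]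
  finite_readers := by simp [init]

theorem balance_init (P : Params) : init.balance P = 0 := by
  simp [balance, init, Forest.potential_empty, pendingReads]
  simp [Forest.empty]

end Detector

/-- From `s` to `s'` the detector does `c` units of amortised work, a unit being `level + 1` steps,
and allocates at most `e` strands. -/
structure Step (P : Params) (s s' : Detector) (c e : ℕ) : Prop where
  wf : s'.Wf
  le_size : s.nsp.size ≤ s'.nsp.size
  size_le : s'.nsp.size ≤ s.nsp.size + e
  balance_le : s'.nsp.size ≤ P.strands →
    s'.balance P ≤ s.balance P + c * (P.level + 1)

/-- A step that keeps the sets of `D_NSP` with their status, the readers, and `R`. -/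
structure Quiet (P : Params) (s s' : Detector) (c e : ℕ) : Prop extends Step P s s' c e where
  root_eq : s'.nsp.root = s.nsp.root
  attached_eq : ∀ x < s.nsp.size, s'.attached x = s.attached x
  readers_eq : s'.readers = s.readers
  insertLog_eq : s'.insertLog = s.insertLog

section Step

variable {P : Params} {s s' s'' : Detector} {c c' e e' : ℕ}

theorem Step.trans (h : Step P s s' c e) (h' : Step P s' s'' c' e') :
    Step P s s'' (c + c') (e + e') where
  wf := h'.wf
  le_size := h.le_size.trans h'.le_size
  size_le := by
    have := h.size_le
    have := h'.size_le
    omega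
  balance_le hN := by
    have := h.balance_le (h'.le_size.trans hN)
    have := h'.balance_le hN
    push_cast
    linarith

theorem Step.weaken (h : Step P s s' c e) (hc : c ≤ c') (he : e ≤ e') : Step P s s' c' e' where
  wf := h.wf
  le_size := h.le_size
  size_le := by
    have := h.size_le
    omega
  balance_le hN := (h.balance_le hN).trans (by gcongr)

theorem Step.of_nsp (hs : s.Wf) {d : Forest} {t : ℕ}
    (h : s'.core = (s.sp, d, s'.att, s.rSize, s.insertLog, s.readers, s.steps + t)) (hd : d.Wf)
    (hsize : d.size = s.nsp.size)
    (hcost : s.nsp.size ≤ P.strands → t + 2 * d.potential P.level P.base ≤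
      2 * s.nsp.potential P.level P.base + c * (P.level + 1)) :
    Step P s s' c 0 := by
  obtain ⟨hsp, rfl, -, hrSize, hlog, hreaders, hsteps⟩ := by
    simpa only [Detector.core, Prod.mk.injEq] using h
  refine ⟨⟨hsp ▸ hs.sp_wf, hd, by rw [hsp, hsize, hs.size_eq], by rw [hrSize, hlog, hs.rSize_eq],
    hlog ▸ hs.insertLog_le, hreaders ▸ hs.finite_readers⟩, hsize.ge, hsize.le, fun hN => ?_⟩
  have := hcost (hsize ▸ hN)
  simp only [Detector.balance, Detector.pendingReads, hsp, hreaders, hlog, hsize, hsteps]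
  zify at this ⊢
  linarith

theorem Quiet.of_sp (hs : s.Wf) {d : Forest} {t : ℕ}
    (h : s'.core = (d, s.nsp, s.att, s.rSize, s.insertLog, s.readers, s.steps + t))
    (hd : d.Wf) (hsize : d.size = s.sp.size)
    (hcost : s.sp.size ≤ P.strands → t + 2 * d.potential P.level P.base ≤
      2 * s.sp.potential P.level P.base + c * (P.level + 1)) :
    Quiet P s s' c 0 := by
  obtain ⟨rfl, hnsp, hatt, hrSize, hlog, hreaders, hsteps⟩ := by
    simpa only [Detector.core, Prod.mk.injEq] using h
  refine ⟨⟨⟨hd, hnsp ▸ hs.nsp_wf, by rw [hnsp, hsize, hs.size_eq],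
    by rw [hrSize, hlog, hs.rSize_eq], hlog ▸ hs.insertLog_le, hreaders ▸ hs.finite_readers⟩,
    by rw [hnsp], by rw [hnsp]; rfl, fun hN => ?_⟩, by rw [hnsp], fun x _ => ?_, hreaders, hlog⟩
  · have := hcost (by rwa [hs.size_eq, ← hnsp])
    simp only [Detector.balance, Detector.pendingReads, hnsp, hreaders, hlog, hsteps]
    zify at this ⊢
    linarith
  · rw [Detector.attached, hatt, hnsp, Detector.attached]

theorem Quiet.trans (h : Quiet P s s' c e) (h' : Quiet P s' s'' c' e') :
    Quiet P s s'' (c + c') (e + e') where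
  toStep := h.toStep.trans h'.toStep
  root_eq := h'.root_eq.trans h.root_eq
  attached_eq x hx := (h'.attached_eq x (hx.trans_le h.le_size)).trans (h.attached_eq x hx)
  readers_eq := h'.readers_eq.trans h.readers_eq
  insertLog_eq := h'.insertLog_eq.trans h.insertLog_eq

theorem Quiet.weaken (h : Quiet P s s' c e) (hc : c ≤ c') (he : e ≤ e') : Quiet P s s' c' e' :=
  { h with toStep := h.toStep.weaken hc he }

theorem Quiet.refl (hs : s.Wf) : Quiet P s s 0 0 :=
  .of_sp (c := 0) (d := s.sp) (t := 0) hs rfl hs.sp_wf rfl fun _ => by omega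

theorem Quiet.congr (h : Quiet P s s' c e) (hcore : s''.core = s'.core) : Quiet P s s'' c e :=
  h.trans (.of_sp (c := 0) (d := s'.sp) (t := 0) h.wf hcore h.wf.sp_wf rfl fun _ => by omega)

end Step

section Primitives

variable (P : Params) {s : Detector} (hs : s.Wf)
include hs

theorem tick_spec (c : ℕ) : Post (tick c) s fun _ s' => Quiet P s s' c 0 :=
  Quiet.of_sp (d := s.sp) (t := c) hs rfl hs.sp_wf rfl fun _ => by
    have := Nat.le_mul_of_pos_right c (Nat.add_one_pos P.level)
    omega

theorem findSP_spec (x : ℕ) : Post (findSP x) s fun _ s' => Quiet P s s' 3 0 := by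
  have hc := Forest.find_compressed hs.sp_wf x
  exact Quiet.of_sp hs rfl (hc.wf hs.sp_wf) hc.size_eq fun hN =>
    Forest.find_steps_le hs.sp_wf (P.rank_le hs.sp_wf hN) x

theorem findNSP_spec (x : ℕ) : Post (findNSP x) s fun r s' =>
    Quiet P s s' 3 0 ∧ r = s'.nsp.root x := by
  have hc := Forest.find_compressed hs.nsp_wf x
  have hroot : (s.nsp.find x).2.1.root = s.nsp.root := funext (hc.root_eq hs.nsp_wf)
  refine ⟨⟨.of_nsp hs rfl (hc.wf hs.nsp_wf) hc.size_eq fun hN =>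
    Forest.find_steps_le hs.nsp_wf (P.rank_le hs.nsp_wf hN) x, hroot, fun y _ => ?_, rfl, rfl⟩, ?_⟩
  · exact congrArg (fun r => (s.att (r y)).isSome) hroot
  · exact (Forest.find_fst s.nsp x).trans (congrFun hroot x).symm

theorem unionSP_spec {x y : ℕ} (hx : x < s.nsp.size) (hy : y < s.nsp.size) :
    Post (unionSP x y) s fun _ s' => Quiet P s s' 13 0 := by
  rw [← hs.size_eq] at hx hy
  have hm := Forest.union_merged hs.sp_wf hx hy
  refine Quiet.of_sp (t := 1 + (s.sp.union x y).2.2) hs ?_ hm.wf hm.size_eq fun hN => ?_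
  · rw [← add_assoc]
    rfl
  · have := Forest.union_steps_le hs.sp_wf hx hy (P.rank_le hs.sp_wf hN)
    omega

theorem newStrand_spec : Post newStrand s fun x s' =>
    Quiet P s s' 18 1 ∧ x < s'.nsp.size ∧ s'.attached x = false ∧
      ∀ y < s.nsp.size, s'.nsp.root y ≠ s'.nsp.root x := by
  have hroot : s.nsp.makeSet.root = s.nsp.root := funext (Forest.makeSet_root hs.nsp_wf)
  have hself : s.nsp.root s.nsp.size = s.nsp.size :=
    Forest.root_eq_self (hs.nsp_wf.parent_eq_self le_rfl)
  have hne : ∀ y < s.nsp.size, s.nsp.root y ≠ s.nsp.size :=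
    fun y hy => (hs.nsp_wf.root_lt hy).ne
  refine ⟨⟨⟨⟨Forest.makeSet_wf hs.sp_wf, Forest.makeSet_wf hs.nsp_wf, congrArg (· + 1) hs.size_eq,
    hs.rSize_eq, hs.insertLog_le, hs.finite_readers⟩, Nat.le_succ _, le_rfl, fun _ => ?_⟩,
    hroot, fun y hy => ?_, rfl, rfl⟩, Nat.lt_succ_self _, ?_, fun y hy => ?_⟩
  · change ((s.steps + 10 : ℕ) : ℤ) + 2 * ((s.sp.makeSet.potential P.level P.base : ℕ) +
      (s.nsp.makeSet.potential P.level P.base : ℕ)) + 17 * (P.level + 1) * s.pendingReads -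
      s.insertLog.sum - 4 * P.base * (s.nsp.size + 1 : ℕ) ≤ _
    rw [Forest.makeSet_potential hs.sp_wf, Forest.makeSet_potential hs.nsp_wf, Detector.balance]
    push_cast
    linarith
  · change (Function.update s.att s.nsp.size none (s.nsp.makeSet.root y)).isSome = _
    rw [hroot, Function.update_of_ne (hne y hy), Detector.attached]
  · change (Function.update s.att s.nsp.size none (s.nsp.makeSet.root s.nsp.size)).isSome = _
    rw [hroot, hself, Function.update_self, Option.isSome_none]
  · change s.nsp.makeSet.root y ≠ s.nsp.makeSet.root s.nsp.size
    rw [hroot, hself]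
    exact hne y hy

theorem toP_spec (x : ℕ) : Post (toP x) s fun _ s' => Quiet P s s' 4 0 :=
  (tick_spec P hs 1).bind fun _ _ h₁ => (findSP_spec P h₁.wf x).bind fun _ _ h₂ =>
    Post.modify ((h₁.trans h₂).congr rfl)

theorem attachedSet_spec (x : ℕ) : Post (attachedSet x) s fun a s' =>
    Quiet P s s' 4 0 ∧ a.isSome = s'.attached x :=
  (tick_spec P hs 1).bind fun _ _ h₁ => (findNSP_spec P h₁.wf x).bind fun _ s₂ h₂ =>
    ⟨h₁.trans h₂.1, congrArg (fun r => (s₂.att r).isSome) h₂.2⟩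

theorem predProxy_spec (x : ℕ) : Post (predProxy x) s fun _ s' => Quiet P s s' 5 0 :=
  (tick_spec P hs 2).bind fun _ _ h₁ => (findNSP_spec P h₁.wf x).bind fun _ _ h₂ => h₁.trans h₂.1

theorem succProxy_spec (x : ℕ) : Post (succProxy x) s fun _ s' => Quiet P s s' 5 0 :=
  (tick_spec P hs 2).bind fun _ _ h₁ => (findNSP_spec P h₁.wf x).bind fun _ _ h₂ => h₁.trans h₂.1

theorem setAttPred_spec (x a : ℕ) : Post (setAttPred x a) s fun _ s' => Quiet P s s' 4 0 :=
  (tick_spec P hs 1).bind fun _ _ h₁ => (findNSP_spec P h₁.wf x).bind fun _ _ h₂ =>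
    Post.modify ((h₁.trans h₂.1).congr rfl)

theorem setAttSucc_spec (x a : ℕ) : Post (setAttSucc x a) s fun _ s' => Quiet P s s' 4 0 :=
  (tick_spec P hs 1).bind fun _ _ h₁ => (findNSP_spec P h₁.wf x).bind fun _ _ h₂ =>
    Post.modify ((h₁.trans h₂.1).congr rfl)

theorem readR_spec (a b : ℕ) : Post (readR a b) s fun _ s' => Quiet P s s' 1 0 :=
  (tick_spec P hs 1).bind fun _ _ h₁ => h₁

end Primitives

/-- From `s` to `s'` only entries of the reachability matrix change, at the cost of `c` steps. -/
def MatrixStep (s s' : Detector) (c : ℕ) : Prop :=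
  ∃ R, s' = { s with reach := R, steps := s.steps + c }

theorem MatrixStep.trans {s s' s'' : Detector} {c c' : ℕ} (h : MatrixStep s s' c)
    (h' : MatrixStep s' s'' c') : MatrixStep s s'' (c + c') := by
  obtain ⟨R, rfl⟩ := h
  obtain ⟨R', rfl⟩ := h'
  exact ⟨R', by rw [← add_assoc]⟩

theorem tick_matrixStep (s : Detector) (c : ℕ) :
    Post (tick c) s fun _ s' => MatrixStep s s' c := ⟨_, rfl⟩

theorem writeR_matrixStep (s : Detector) (a b : ℕ) (v : Bool) :
    Post (writeR a b v) s fun _ s' => MatrixStep s s' 1 := ⟨_, rfl⟩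

theorem reachesAny_matrixStep (s : Detector) (y : ℕ) (ps : List ℕ) :
    Post (reachesAny y ps) s fun _ s' => MatrixStep s s' ps.length := by
  induction ps generalizing s with
  | nil => exact ⟨_, rfl⟩
  | cons p ps ih =>
    rw [List.length_cons, add_comm]
    exact (tick_matrixStep s 1).bind fun _ s₁ h₁ => (ih s₁).mono fun _ _ h₂ => h₁.trans h₂

theorem reachedFromAny_matrixStep (s : Detector) (y : ℕ) (qs : List ℕ) :
    Post (reachedFromAny y qs) s fun _ s' => MatrixStep s s' qs.length := by
  induction qs generalizing s with
  | nil => exact ⟨_, rfl⟩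
  | cons q qs ih =>
    rw [List.length_cons, add_comm]
    exact (tick_matrixStep s 1).bind fun _ s₁ h₁ => (ih s₁).mono fun _ _ h₂ => h₁.trans h₂

theorem fillR_matrixStep (s : Detector) (x : ℕ) (ps qs : List ℕ) (y : ℕ) :
    Post (fillR x ps qs y) s fun _ s' => MatrixStep s s' (y * (ps.length + qs.length + 2)) := by
  induction y generalizing s with
  | zero => exact ⟨_, by rw [zero_mul]; rfl⟩
  | succ y ih =>
    have hcost : (y + 1) * (ps.length + qs.length + 2) =
        ps.length + 1 + qs.length + 1 + y * (ps.length + qs.length + 2) := by ring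
    rw [hcost]
    exact (reachesAny_matrixStep s y ps).bind fun _ s₁ h₁ =>
      (writeR_matrixStep s₁ y x _).bind fun _ s₂ h₂ =>
      (reachedFromAny_matrixStep s₂ y qs).bind fun _ s₃ h₃ =>
      (writeR_matrixStep s₃ x y _).bind fun _ s₄ h₄ =>
      (ih s₄).mono fun _ _ h₅ => (((h₁.trans h₂).trans h₃).trans h₄).trans h₅

/-- A step in which a single node is inserted into `R`; the insertion is paid for by its entry in
the log. -/
structure Insert (P : Params) (s s' : Detector) : Prop extends Step P s s' 0 0 where
  nsp_eq : s'.nsp = s.nsp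
  att_eq : s'.att = s.att
  length_insertLog : s'.insertLog.length = s.insertLog.length + 1

theorem insertR_spec (P : Params) {s : Detector} (hs : s.Wf) {ps qs : List ℕ}
    (h : ps.length + qs.length ≤ 3) : Post (insertR ps qs) s fun _ s' => Insert P s s' := by
  refine Post.get ((tick_matrixStep s 2).bind fun _ s₁ h₁ =>
    (fillR_matrixStep s₁ _ ps qs s.rSize).bind fun _ s₂ h₂ =>
    (writeR_matrixStep s₂ _ _ false).bind fun _ s₃ h₃ => ?_)
  obtain ⟨R, rfl⟩ := (h₁.trans h₂).trans h₃
  set c := 2 + s.rSize * (ps.length + qs.length + 2) + 1 with _hc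
  have hlog_le : ∀ t ∈ (s.steps + c - s.steps) :: s.insertLog,
      t ≤ 5 * (s.insertLog.length + 1) + 3 := by
    have := Nat.mul_le_mul_left s.rSize (show ps.length + qs.length + 2 ≤ 5 by omega)
    have := hs.rSize_eq
    exact List.forall_mem_cons.mpr ⟨by omega, fun t ht => (hs.insertLog_le t ht).trans (by omega)⟩
  refine ⟨⟨⟨hs.sp_wf, hs.nsp_wf, hs.size_eq, congrArg (· + 1) hs.rSize_eq, hlog_le,
    hs.finite_readers⟩, le_rfl, le_rfl, fun _ => ?_⟩, rfl, rfl, rfl⟩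
  change ((s.steps + c : ℕ) : ℤ) + 2 * (s.sp.potential _ _ + s.nsp.potential _ _) +
    17 * (P.level + 1) * s.pendingReads - ((s.steps + c - s.steps) :: s.insertLog).sum -
    4 * P.base * s.nsp.size ≤ _
  rw [Nat.add_sub_cancel_left, List.sum_cons, Detector.balance]
  push_cast
  linarith

/-! ### Live strands and the number of insertions -/

/-- The strands of `A` exist, and no two of them share an unattached set.  The strands that can
still take part in parallel control are kept live. -/
structure Live (s : Detector) (A : List ℕ) : Prop where
  lt_size : ∀ x ∈ A, x < s.nsp.size
  distinct : A.Pairwise fun x y => s.nsp.root x = s.nsp.root y → s.attached x = true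

/-- The number of insertions into `R` so far, and two more for every live strand in an attached set.
Joining two such strands inserts two nodes into `R`, but leaves one strand for two. -/
def Detector.charge (s : Detector) (A : List ℕ) : ℕ :=
  s.insertLog.length + 2 * A.countP s.attached

/-- A step that replaces the live strands `A` by `B` and raises the charge by at most `r`. -/
structure Advance (P : Params) (s : Detector) (A : List ℕ) (s' : Detector) (B : List ℕ)
    (c e r : ℕ) : Prop extends Step P s s' c e where
  live : Live s' B
  charge_le : s'.charge B ≤ s.charge A + r

section Live

variable {P : Params} {s s' s'' : Detector} {A B D : List ℕ} {x y c e r c' e' r' : ℕ}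

theorem Detector.charge_cons (s : Detector) (x : ℕ) (A : List ℕ) :
    s.charge (x :: A) = s.charge A + if s.attached x = true then 2 else 0 := by
  simp only [charge, List.countP_cons]
  split_ifs <;> omega

theorem Detector.charge_mono (s : Detector) (hBA : B.Subperm A) : s.charge B ≤ s.charge A :=
  Nat.add_le_add_left (Nat.mul_le_mul_left 2 (hBA.countP_le s.attached)) _

theorem Live.subperm (h : Live s A) (hBA : B.Subperm A) : Live s B := by
  obtain ⟨D, hDB, hDA⟩ := hBA
  exact ⟨fun x hx => h.lt_size x (hDA.subset (hDB.mem_iff.mpr hx)),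
    (h.distinct.sublist hDA).perm hDB fun {x y} hxy he =>
      (Detector.attached_congr he).trans (hxy he.symm)⟩

theorem Live.tail (h : Live s (x :: A)) : Live s A := h.subperm (List.sublist_cons_self x A).subperm

theorem Live.root_ne (h : Live s (x :: A)) (hx : s.attached x = false) :
    ∀ y ∈ A, s.nsp.root y ≠ s.nsp.root x := fun y hy he =>
  Bool.false_ne_true (hx.symm.trans ((List.pairwise_cons.mp h.distinct).1 y hy he.symm))

theorem Live.cons (h : Live s A) (hx : x < s.nsp.size)
    (hA : ∀ y ∈ A, s.nsp.root x = s.nsp.root y → s.attached x = true) : Live s (x :: A) :=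
  ⟨List.forall_mem_cons.mpr ⟨hx, h.lt_size⟩, List.pairwise_cons.mpr ⟨hA, h.distinct⟩⟩

theorem Live.transfer (h : Live s A) (hsize : s.nsp.size ≤ s'.nsp.size)
    (hroot : ∀ x ∈ A, ∀ y ∈ A, s'.nsp.root x = s'.nsp.root y → s.nsp.root x = s.nsp.root y)
    (hatt : ∀ x ∈ A, s.attached x = true → s'.attached x = true) : Live s' A :=
  ⟨fun x hx => (h.lt_size x hx).trans_le hsize,
    h.distinct.imp_of_mem fun {x y} hx hy hxy he => hatt x hx (hxy (hroot x hx y hy he))⟩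

theorem Advance.of_step (hA : Live s A) (h : Step P s s' c e)
    (hroot : ∀ x ∈ A, ∀ y ∈ A, s'.nsp.root x = s'.nsp.root y → s.nsp.root x = s.nsp.root y)
    (hatt : ∀ x ∈ A, s'.attached x = s.attached x)
    (hlog : s'.insertLog.length = s.insertLog.length) : Advance P s A s' A c e 0 where
  toStep := h
  live := hA.transfer h.le_size hroot fun x hx hx' => (hatt x hx).trans hx'
  charge_le := by
    rw [Detector.charge, hlog, List.countP_congr fun x hx => by rw [hatt x hx], Detector.charge]
    rfl

theorem Advance.of_quiet (hA : Live s A) (h : Quiet P s s' c e) : Advance P s A s' A c e 0 :=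
  .of_step hA h.toStep (fun x _ y _ hxy => by rwa [h.root_eq] at hxy)
    (fun x hx => h.attached_eq x (hA.lt_size x hx)) (congrArg List.length h.insertLog_eq)

theorem Advance.of_insert (hA : Live s A) (h : Insert P s s') : Advance P s A s' A 0 0 1 where
  toStep := h.toStep
  live := hA.transfer h.le_size (fun x _ y _ hxy => by rwa [h.nsp_eq] at hxy) fun x _ hx => by
    rwa [Detector.attached, h.att_eq, h.nsp_eq]
  charge_le := by
    have : s'.attached = s.attached := funext fun x => by
      rw [Detector.attached, h.att_eq, h.nsp_eq, Detector.attached]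
    rw [Detector.charge, this, h.length_insertLog, Detector.charge]
    omega

theorem Advance.subperm (h : Advance P s A s' B c e r) (hDB : D.Subperm B) :
    Advance P s A s' D c e r where
  toStep := h.toStep
  live := h.live.subperm hDB
  charge_le := (s'.charge_mono hDB).trans h.charge_le

theorem Advance.mono_left (h : Advance P s B s' D c e r) (hBA : B.Subperm A) :
    Advance P s A s' D c e r :=
  ⟨h.toStep, h.live, h.charge_le.trans (Nat.add_le_add_right (s.charge_mono hBA) r)⟩

theorem Advance.trans (h : Advance P s A s' B c e r) (h' : Advance P s' B s'' D c' e' r') :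
    Advance P s A s'' D (c + c') (e + e') (r + r') where
  toStep := h.toStep.trans h'.toStep
  live := h'.live
  charge_le := by
    have := h.charge_le
    have := h'.charge_le
    omega

theorem Advance.trans_quiet (h : Advance P s A s' B c e r) (h' : Quiet P s' s'' c' e') :
    Advance P s A s'' B (c + c') (e + e') r :=
  h.trans (.of_quiet h.live h')

theorem Advance.weaken (h : Advance P s A s' B c e r) (hc : c ≤ c') (he : e ≤ e') (hr : r ≤ r') :
    Advance P s A s' B c' e' r' where
  toStep := h.toStep.weaken hc he
  live := h.live
  charge_le := h.charge_le.trans (by omega)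

theorem Advance.tail (h : Advance P s A s' (x :: B) c e r) : Advance P s A s' B c e r :=
  h.subperm (List.sublist_cons_self x B).subperm

theorem Advance.replace (h : Advance P s A s' (x :: B) c e r)
    (hxy : s'.nsp.root y = s'.nsp.root x) (hy : y < s'.nsp.size) :
    Advance P s A s' (y :: B) c e r where
  toStep := h.toStep
  live := h.live.tail.cons hy fun z hz he => (Detector.attached_congr hxy).trans
    ((List.pairwise_cons.mp h.live.distinct).1 z hz (hxy.symm.trans he))
  charge_le := by
    rw [Detector.charge_cons, Detector.attached_congr hxy, ← Detector.charge_cons]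
    exact h.charge_le

theorem Live.merged (hA : Live s (y :: A)) (hy : s.attached y = false)
    (hm : s.nsp.Merged s'.nsp x y r)
    (hatt : s'.att = Function.update s.att r (s.att (s.nsp.root x)))
    (hlog : s'.insertLog = s.insertLog) (h : Step P s s' c e) :
    Advance P s (y :: A) s' A c e 0 ∧ ∀ z ∈ A, s'.attached z = s.attached z := by
  have hne := hA.root_ne hy
  have hroot : ∀ z ∈ A, s'.nsp.root z = if s.nsp.root z = s.nsp.root x then r
      else s.nsp.root z := fun z hz => by
    simpa only [hne z hz, or_false] using hm.root_eq z
  have hrep : ∀ z ∈ A, s.nsp.root z = r → s.nsp.root z = s.nsp.root x := fun z hz he =>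
    hm.rep.elim he.trans fun h => absurd (he.trans h) (hne z hz)
  have hatt : ∀ z ∈ A, s'.attached z = s.attached z := fun z hz => by
    rw [Detector.attached, hatt, hroot z hz]
    split_ifs with hzx
    · rw [Function.update_self, Detector.attached, hzx]
    · rw [Function.update_of_ne fun he => hzx (hrep z hz he), Detector.attached]
  have hstep : Advance P s A s' A c e 0 := .of_step hA.tail h (fun z hz w hw he => ?_) hatt
    (congrArg _ hlog)
  · exact ⟨hstep.mono_left (List.sublist_cons_self y A).subperm, hatt⟩
  rw [hroot z hz, hroot w hw] at he
  split_ifs at he with hzx hwx hwx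
  · exact hzx.trans hwx.symm
  · exact absurd (hrep w hw he.symm) hwx
  · exact absurd (hrep z hz he) hzx
  · exact he

end Live

section

variable (P : Params) {s : Detector} (hs : s.Wf) {A : List ℕ} {x y : ℕ}
include hs

theorem newStrand_live_spec (hA : Live s A) : Post newStrand s fun x s' =>
    Advance P s A s' (x :: A) 18 1 0 ∧ s'.attached x = false ∧
      ∀ y ∈ A, s'.attached y = s.attached y := by
  refine (newStrand_spec P hs).mono fun x s' ⟨hq, hx, hatt, hne⟩ => ?_
  have h := Advance.of_quiet hA hq
  refine ⟨⟨h.toStep, h.live.cons hx fun y hy he => absurd he.symm (hne y (hA.lt_size y hy)), ?_⟩,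
    hatt, fun y hy => hq.attached_eq y (hA.lt_size y hy)⟩
  rw [Detector.charge_cons, hatt]
  exact h.charge_le

theorem unionNSP_spec (hx : x < s.nsp.size) (hA : Live s (y :: A)) (hy : s.attached y = false) :
    Post (unionNSP x y) s fun _ s' => Advance P s (y :: A) s' A 21 0 0 ∧
      s'.nsp.root y = s'.nsp.root x ∧ ∀ z ∈ A, s'.attached z = s.attached z := by
  refine (tick_spec P hs 6).bind fun _ s₁ h₁ => (findNSP_spec P h₁.wf x).bind ?_
  rintro _ s₂ ⟨h₂, rfl⟩
  have h₁₂ := h₁.trans h₂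
  have hA₂ := Advance.of_quiet hA h₁₂
  have hx₂ := hx.trans_le h₁₂.le_size
  have hy₂ := hA₂.live.lt_size y List.mem_cons_self
  have hm := Forest.union_merged h₂.wf.nsp_wf hx₂ hy₂
  have hunattached := (h₁₂.attached_eq y (hA.lt_size y List.mem_cons_self)).trans hy
  refine Post.mono (Q := fun _ s' => (Advance P s₂ (y :: A) s' A 12 0 0 ∧
    ∀ z ∈ A, s'.attached z = s₂.attached z) ∧ s'.nsp.root y = s'.nsp.root x) ?_ ?_
  · exact ⟨hA₂.live.merged hunattached hm rfl rfl
      (.of_nsp (d := (s₂.nsp.union x y).2.1) (t := (s₂.nsp.union x y).2.2) h₂.wf rfl hm.wf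
        hm.size_eq fun hN =>
          Forest.union_steps_le h₂.wf.nsp_wf hx₂ hy₂ (P.rank_le h₂.wf.nsp_wf hN)),
      (hm.root_eq y).trans ((if_pos (.inr rfl)).trans
        ((hm.root_eq x).trans (if_pos (.inl rfl))).symm)⟩
  · rintro _ s' ⟨⟨hA₃, hatt⟩, hroot⟩
    exact ⟨hA₂.trans hA₃, hroot, fun z hz => (hatt z hz).trans
      (h₁₂.attached_eq z (hA.lt_size z (List.mem_cons_of_mem y hz)))⟩

theorem setAttached_spec (hA : Live s (x :: A)) (a : ℕ) :
    Post (setAttached x a) s fun _ s' => Advance P s A s' A 4 0 0 ∧ Live s' (x :: A) := by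
  refine (tick_spec P hs 1).bind fun _ s₁ h₁ => (findNSP_spec P h₁.wf x).bind ?_
  rintro _ s₂ ⟨h₂, rfl⟩
  refine Post.modify ?_
  set s' : Detector := { s₂ with att := Function.update s₂.att (s₂.nsp.root x) (some a) }
  have h₁₂ := h₁.trans h₂
  have hA₂ := (Advance.of_quiet hA h₁₂).live
  have hstep : Step P s₂ s' 0 0 :=
    .of_nsp (c := 0) (d := s₂.nsp) (t := 0) h₂.wf rfl h₂.wf.nsp_wf rfl fun _ => by omega
  have hatt : ∀ y, s'.attached y = if s₂.nsp.root y = s₂.nsp.root x then true else s₂.attached y :=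
    fun y => Detector.attached_update
  refine ⟨(Advance.of_quiet hA.tail h₁₂).trans (.of_step hA₂.tail hstep (fun _ _ _ _ h => h)
    (fun y hy => ?_) rfl), hA₂.transfer le_rfl (fun _ _ _ _ h => h) fun y _ hy => ?_⟩
  · rw [hatt]
    split_ifs with hr
    · exact ((List.pairwise_cons.mp hA₂.distinct).1 y hy hr.symm).symm.trans
        (Detector.attached_congr hr.symm)
    · rfl
  · rw [hatt, hy, ite_self]

theorem attachify_spec (hA : Live s (x :: A)) {qs : List ℕ} (hqs : qs.length ≤ 2) :
    Post (attachify x qs) s fun _ s' => Advance P s (x :: A) s' A 13 0 1 := by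
  refine (attachedSet_spec P hs x).bind fun a s₁ ⟨h₁, _⟩ => ?_
  rcases a with _ | a
  · refine (predProxy_spec P h₁.wf x).bind fun p s₂ h₂ =>
      (insertR_spec P h₂.wf (ps := [p]) (by rw [List.length_singleton]; omega)).bind
        fun a s₃ h₃ => ?_
    have hA₂ := Advance.of_quiet hA (h₁.trans h₂)
    exact (setAttached_spec P h₃.wf (Advance.of_insert hA₂.live h₃).live a).bind fun _ _ ⟨h₄, _⟩ =>
      (hA₂.tail.trans (.of_insert hA₂.live.tail h₃)).trans h₄
  · exact (Advance.of_quiet hA h₁).tail.weaken (by omega) le_rfl (by omega)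

theorem attachNew_spec (hA : Live s (x :: A)) {ps : List ℕ} (hps : ps.length ≤ 3) :
    Post (attachNew x ps) s fun _ s' => Advance P s (x :: A) s' (x :: A) 4 0 3 := by
  refine (insertR_spec P hs (qs := []) hps).bind fun a s₁ h₁ => ?_
  refine (setAttached_spec P h₁.wf (Advance.of_insert hA h₁).live a).mono fun _ s₂ ⟨h₂, hlive⟩ => ?_
  have h := (Advance.of_insert hA.tail h₁).trans h₂
  refine ⟨h.toStep.weaken (by omega) le_rfl, hlive, ?_⟩
  have := h.charge_le
  rw [Detector.charge_cons, Detector.charge_cons]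
  split_ifs <;> omega

end

/-! ### Parallel control -/

section Join

variable (P : Params) {s : Detector} (hs : s.Wf) {A B : List ℕ} {f j t o c v w : ℕ}
include hs

theorem join_unattached_spec (hB : Live s B) (hp : (o :: t :: j :: f :: A).Perm B)
    (ho : s.attached o = false) (ht : s.attached t = false) (hj : s.attached j = false) :
    Post (do unionNSP f o; unionNSP f t; unionNSP f j; return j) s fun j' s' =>
      Advance P s B s' (j' :: A) 63 0 0 := by
  have hA := hB.subperm hp.subperm
  refine (unionNSP_spec P hs (hA.lt_size f (by simp)) hA ho).bind fun _ s₁ ⟨h₁, _, hatt₁⟩ => ?_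
  refine (unionNSP_spec P h₁.wf (h₁.live.lt_size f (by simp)) h₁.live
    ((hatt₁ t (by simp)).trans ht)).bind fun _ s₂ ⟨h₂, _, hatt₂⟩ => ?_
  refine (unionNSP_spec P h₂.wf (h₂.live.lt_size f (by simp)) h₂.live
    ((hatt₂ j (by simp)).trans ((hatt₁ j (by simp)).trans hj))).bind fun _ s₃ ⟨h₃, hroot, _⟩ => ?_
  exact Post.pure ((((h₁.trans h₂).trans h₃).replace hroot
    ((h₂.live.lt_size j (by simp)).trans_le h₃.le_size)).mono_left hp.subperm)

theorem absorb_join_spec (hA : Live s (j :: t :: A)) (hj : s.attached j = false) (a : ℕ) :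
    Post (do unionNSP t j; setAttSucc o a; return j) s fun j' s' =>
      Advance P s (j :: t :: A) s' (j' :: A) 25 0 0 := by
  refine (unionNSP_spec P hs (hA.lt_size t (by simp)) hA hj).bind fun _ s₁ ⟨h₁, hroot, _⟩ =>
    (setAttSucc_spec P h₁.wf o a).bind fun _ s₂ h₂ => Post.pure ?_
  exact (h₁.replace hroot ((hA.lt_size j (by simp)).trans_le h₁.le_size)).trans_quiet h₂

theorem join_mixed_spec (hB : Live s B) (hp : (o :: f :: j :: t :: A).Perm B)
    (hc : c < s.nsp.size) (hj : s.attached j = false) (a : ℕ) :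
    Post (do
      if (← attachedSet f).isNone then unionNSP c f
      unionNSP t j
      setAttSucc o a
      return j) s fun j' s' => Advance P s B s' (j' :: A) 50 0 0 := by
  have hA := hB.subperm hp.subperm
  refine (attachedSet_spec P hs f).bind fun b s₁ ⟨h₁, hb⟩ => ?_
  have hA₁ := ((Advance.of_quiet hA h₁).mono_left hp.subperm).tail
  have hj₁ := (h₁.attached_eq j (hA.lt_size j (by simp))).trans hj
  rcases b with _ | b
  · refine (unionNSP_spec P h₁.wf (hc.trans_le h₁.le_size) hA₁.live hb.symm).bind
      fun _ s₂ ⟨h₂, _, hatt₂⟩ => ?_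
    exact (absorb_join_spec P h₂.wf h₂.live ((hatt₂ j (by simp)).trans hj₁) a).mono
      fun _ _ h₃ => (hA₁.trans h₂).trans h₃
  · exact (absorb_join_spec P h₁.wf hA₁.live.tail hj₁ a).mono fun _ _ h₂ =>
      (hA₁.tail.trans h₂).weaken (by omega) le_rfl le_rfl

theorem join_attached_spec (hB : Live s B) (hp : (o :: t :: f :: j :: A).Perm B)
    (ho : s.attached o = true) (ht : s.attached t = true) (a₁ a₂ : ℕ) :
    Post (do
      let c₁ ← attachedSet v
      let c₂ ← attachedSet w
      let _ ← attachify f (c₁.toList ++ c₂.toList)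
      attachNew j [a₁, a₂]
      return j) s fun j' s' => Advance P s B s' (j' :: A) 25 0 0 := by
  refine (attachedSet_spec P hs v).bind fun c₁ s₁ ⟨h₁, _⟩ =>
    (attachedSet_spec P h₁.wf w).bind fun c₂ s₂ ⟨h₂, _⟩ => ?_
  have hA₂ := Advance.of_quiet (hB.subperm hp.subperm).tail.tail (h₁.trans h₂)
  refine (attachify_spec P h₂.wf hA₂.live (by cases c₁ <;> cases c₂ <;> simp)).bind
    fun _ s₃ h₃ => (attachNew_spec P h₃.wf h₃.live (by simp)).bind fun _ s₄ h₄ => Post.pure ?_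
  have h := (hA₂.trans h₃).trans h₄
  have hcharge := s.charge_mono hp.subperm
  rw [Detector.charge_cons, Detector.charge_cons, if_pos ho, if_pos ht] at hcharge
  have := h.charge_le
  exact ⟨h.toStep, h.live, by omega⟩

end Join

theorem joinOne_spec (P : Params) {s : Detector} (hs : s.Wf) {A : List ℕ} {first t : ℕ}
    {J : Pending} (hfirst : first < s.nsp.size) (hchild : J.child < s.nsp.size)
    (hcont : J.cont < s.nsp.size) (hA : Live s (t :: J.fork :: J.childEnd :: A)) :
    Post (joinOne first t J) s fun j s' =>
      Advance P s (t :: J.fork :: J.childEnd :: A) s' (j :: A) 120 1 0 := by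
  refine (tick_spec P hs 1).bind fun _ s₁ h₁ => ?_
  have hA₁ := Advance.of_quiet hA h₁
  refine (newStrand_live_spec P h₁.wf hA₁.live).bind fun j s₂ ⟨h₂, hj₂, _⟩ => ?_
  have h₀₂ := hA₁.trans h₂
  refine (unionSP_spec P h₂.wf (hfirst.trans_le h₀₂.le_size)
    (hchild.trans_le h₀₂.le_size)).bind fun _ s₃ h₃ => ?_
  refine (unionSP_spec P h₃.wf (hfirst.trans_le (h₀₂.le_size.trans h₃.le_size))
    ((h₂.live.lt_size j (by simp)).trans_le h₃.le_size)).bind fun _ s₄ h₄ => ?_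
  refine (attachedSet_spec P h₄.wf J.childEnd).bind fun a₁ s₅ ⟨h₅, ha₁⟩ =>
    (attachedSet_spec P h₅.wf t).bind fun a₂ s₆ ⟨h₆, ha₂⟩ => ?_
  have h₂₆ := ((h₃.trans h₄).trans h₅).trans h₆
  have h₀₆ := h₀₂.trans_quiet h₂₆
  have hj₆ := (h₂₆.attached_eq j (h₂.live.lt_size j (by simp))).trans hj₂
  have ho₆ : s₆.attached J.childEnd = a₁.isSome := (h₆.attached_eq _
    ((h₂.live.lt_size _ (by simp)).trans_le ((h₃.trans h₄).trans h₅).le_size)).trans ha₁.symm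
  suffices Post _ s₆ fun j' s' => Advance P s₆ (j :: t :: J.fork :: J.childEnd :: A) s' (j' :: A)
      63 0 0 from this.mono fun _ _ h => (h₀₆.trans h).weaken (by omega) (by omega) le_rfl
  rcases a₁ with _ | a₁ <;> rcases a₂ with _ | a₂
  · exact join_unattached_spec P h₆.wf h₀₆.live (by grind) ho₆ ha₂.symm hj₆
  · exact (join_mixed_spec P h₆.wf h₀₆.live (by grind) (hcont.trans_le h₀₆.le_size) hj₆ _).mono
      fun _ _ h => h.weaken (by omega) le_rfl le_rfl
  · exact (join_mixed_spec P h₆.wf h₀₆.live (by grind) (hchild.trans_le h₀₆.le_size) hj₆ _).mono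
      fun _ _ h => h.weaken (by omega) le_rfl le_rfl
  · exact (join_attached_spec P h₆.wf h₀₆.live (by grind) ho₆ ha₂.symm _ _).mono
      fun _ _ h => h.weaken (by omega) le_rfl le_rfl

/-- The strands that the outstanding children keep live. -/
def liveOf (pend : List Pending) : List ℕ := pend.flatMap fun J => [J.fork, J.childEnd]

/-- The first strand of the current function instance and those of the branches of its outstanding
spawns have been allocated. -/
structure Frame (s : Detector) (first : ℕ) (pend : List Pending) : Prop where
  first_lt : first < s.nsp.size
  branch_lt : ∀ J ∈ pend, J.child < s.nsp.size ∧ J.cont < s.nsp.size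

section Control

variable {s s' : Detector} {A : List ℕ} {first t u : ℕ} {pend : List Pending}

theorem Frame.mono (h : Frame s first pend) (hs : s.nsp.size ≤ s'.nsp.size) :
    Frame s' first pend :=
  ⟨h.first_lt.trans_le hs, fun J hJ => (h.branch_lt J hJ).imp hs.trans_lt' hs.trans_lt'⟩

theorem onSync_spec (P : Params) (hs : s.Wf) (hframe : Frame s first pend)
    (hA : Live s (t :: (liveOf pend ++ A))) :
    Post (onSync first t pend) s fun j s' => Advance P s (t :: (liveOf pend ++ A)) s' (j :: A)
      (120 * pend.length) pend.length 0 := by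
  induction pend generalizing s t with
  | nil => exact Advance.of_quiet hA (.refl hs)
  | cons J js ih =>
    obtain ⟨⟨hchild, hcont⟩, hjs⟩ := List.forall_mem_cons.mp hframe.branch_lt
    have hframe' : Frame s first js := ⟨hframe.first_lt, hjs⟩
    refine (joinOne_spec P hs hframe.first_lt hchild hcont hA).bind fun j s₁ h₁ => ?_
    exact (ih h₁.wf (hframe'.mono h₁.le_size) h₁.live).mono fun _ _ h₂ => (h₁.trans h₂).weaken
      (by rw [List.length_cons]; omega) (by rw [List.length_cons]; omega) le_rfl

variable (P : Params) (hs : s.Wf)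
include hs

theorem onSpawn_spec (hfirst : first < s.nsp.size) (hA : Live s (u :: A)) :
    Post (onSpawn first u) s fun vw s' =>
      Advance P s (u :: A) s' (vw.1 :: vw.2 :: u :: A) 62 2 0 := by
  refine (newStrand_live_spec P hs hA).bind fun v s₁ ⟨h₁, _, _⟩ =>
    (newStrand_live_spec P h₁.wf h₁.live).bind fun w s₂ ⟨h₂, _, _⟩ => ?_
  have h₀₂ := h₁.trans h₂
  refine (unionSP_spec P h₂.wf (hfirst.trans_le h₀₂.le_size)
    (h₂.live.lt_size w (by simp))).bind fun _ s₃ h₃ =>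
    (predProxy_spec P h₃.wf u).bind fun a s₄ h₄ =>
    (setAttPred_spec P h₄.wf v a).bind fun _ s₅ h₅ =>
    (setAttPred_spec P h₅.wf w a).bind fun _ s₆ h₆ => Post.pure ?_
  exact (h₀₂.trans_quiet (((h₃.trans h₄).trans h₅).trans h₆)).subperm (List.Perm.swap _ _ _).subperm

theorem onCreate_spec (hfirst : first < s.nsp.size) (hA : Live s (u :: A)) :
    Post (onCreate first u) s fun vw s' => Advance P s (u :: A) s' (vw.1 :: vw.2 :: A) 70 2 7 := by
  refine (newStrand_live_spec P hs hA).bind fun v s₁ ⟨h₁, _, _⟩ =>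
    (newStrand_live_spec P h₁.wf h₁.live).bind fun w s₂ ⟨h₂, _, _⟩ => ?_
  have h₀₂ := h₁.trans h₂
  refine (unionSP_spec P h₂.wf (hfirst.trans_le h₀₂.le_size)
    (h₂.live.lt_size w (by simp))).bind fun _ s₃ h₃ => ?_
  have hp : (u :: v :: w :: A).Perm (w :: v :: u :: A) := by grind
  have h₀₃ := (h₀₂.trans_quiet h₃).subperm hp.subperm
  refine (attachify_spec P h₃.wf h₀₃.live (by simp)).bind fun a s₄ h₄ =>
    (attachNew_spec P h₄.wf h₄.live (by simp)).bind fun _ s₅ h₅ => ?_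
  have h₀₅ := ((h₀₃.trans h₄).trans h₅).subperm (List.Perm.swap v w A).subperm
  exact (attachNew_spec P h₅.wf h₀₅.live (by simp)).bind fun _ s₆ h₆ =>
    Post.pure ((h₀₅.trans h₆).subperm (List.Perm.swap w v A).subperm)

theorem onGet_spec (hfirst : first < s.nsp.size) (hA : Live s (u :: A)) (i : ℕ) :
    Post (onGet first u i) s fun w s' => Advance P s (u :: A) s' (w :: A) 53 1 4 := by
  refine (newStrand_live_spec P hs hA).bind fun w s₁ ⟨h₁, _, _⟩ => ?_
  refine (unionSP_spec P h₁.wf (hfirst.trans_le h₁.le_size)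
    (h₁.live.lt_size w (by simp))).bind fun _ s₂ h₂ => ?_
  have h₀₂ := (h₁.trans_quiet h₂).subperm (List.Perm.swap w u A).subperm
  refine (attachify_spec P h₂.wf h₀₂.live (by simp)).bind fun a s₃ h₃ =>
    (tick_spec P h₃.wf 1).bind fun _ s₄ h₄ => Post.get ?_
  refine (attachedSet_spec P h₄.wf (s₄.futLast i)).bind fun b s₅ ⟨h₅, _⟩ => ?_
  have h₀₅ := (h₀₂.trans h₃).trans_quiet (h₄.trans h₅)
  exact (attachNew_spec P h₅.wf h₀₅.live (by cases b <;> simp)).bind fun _ s₆ h₆ =>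
    Post.pure (h₀₅.trans h₆)

theorem newFuture_spec : Post newFuture s fun _ s' => Quiet P s s' 1 0 :=
  (tick_spec P hs 1).bind fun _ _ h => h.congr rfl

theorem finishFuture_spec (i t : ℕ) : Post (finishFuture i t) s fun _ s' => Quiet P s s' 1 0 :=
  (tick_spec P hs 1).bind fun _ _ h => Post.modify (h.congr rfl)

end Control

/-! ### Memory accesses -/

section Memory

variable {P : Params} {s s' : Detector} {A B : List ℕ}

theorem query_spec (P : Params) (hs : s.Wf) (u v : ℕ) :
    Post (query u v) s fun _ s' => Quiet P s s' 15 0 := by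
  refine (tick_spec P hs 1).bind fun _ s₁ h₁ => (findSP_spec P h₁.wf u).bind fun r s₂ h₂ =>
    Post.get ?_
  have h₀₂ := h₁.trans h₂
  split_ifs
  · exact Post.pure (h₀₂.weaken (by omega) le_rfl)
  · refine (succProxy_spec P h₂.wf u).bind fun a s₃ h₃ => ?_
    rcases a with _ | a
    · exact Post.pure ((h₀₂.trans h₃).weaken (by omega) le_rfl)
    · exact (predProxy_spec P h₃.wf v).bind fun b s₄ h₄ => (readR_spec P h₄.wf a b).mono
        fun _ _ h₅ => ((h₀₂.trans h₃).trans h₄).trans h₅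

theorem checkRace_spec (P : Params) (hs : s.Wf) (l u v : ℕ) :
    Post (checkRace l u v) s fun _ s' => Quiet P s s' 16 0 := by
  refine (query_spec P hs u v).bind fun b s₁ h₁ => ?_
  split_ifs
  · exact (tick_spec P h₁.wf 1).bind fun _ s₂ h₂ => Post.modify ((h₁.trans h₂).congr rfl)
  · exact Post.pure (h₁.weaken (by omega) le_rfl)

theorem checkAll_spec (P : Params) (hs : s.Wf) (l v : ℕ) (us : List ℕ) :
    Post (checkAll l v us) s fun _ s' => Quiet P s s' (17 * us.length) 0 := by
  induction us generalizing s with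
  | nil => exact Quiet.refl hs
  | cons u us ih =>
    exact (tick_spec P hs 1).bind fun _ s₁ h₁ => (checkRace_spec P h₁.wf l u v).bind
      fun _ s₂ h₂ => (ih h₂.wf).mono fun _ s₃ h₃ => ((h₁.trans h₂).trans h₃).weaken
        (by rw [List.length_cons]; omega) le_rfl

theorem Step.set_readers {c c' e : ℕ} (h : Step P s s' c e) {lw : ℕ → Option ℕ} {l : ℕ}
    {rs : List ℕ} (hc : c + 17 * rs.length ≤ c' + 17 * (s'.readers l).length) :
    Step P s { s' with lastWriter := lw, readers := Function.update s'.readers l rs } c' e := by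
  obtain ⟨hs, hle, hsize, hbalance⟩ := h
  refine ⟨⟨hs.sp_wf, hs.nsp_wf, hs.size_eq, hs.rSize_eq, hs.insertLog_le,
    Detector.finite_readers_update hs l rs⟩, hle, hsize, fun hN => ?_⟩
  set s'' : Detector :=
    { s' with lastWriter := lw, readers := Function.update s'.readers l rs } with hs''
  have hreads : s''.pendingReads + (s'.readers l).length = s'.pendingReads + rs.length :=
    Detector.pendingReads_update hs rfl
  have hbalance' : s''.balance P = s'.balance P +
      17 * (P.level + 1) * (s''.pendingReads - s'.pendingReads) := by
    simp only [Detector.balance, hs'']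
    ring
  have := hbalance hN
  zify at hreads hc
  nlinarith [mul_le_mul_of_nonneg_right hc (by positivity : (0 : ℤ) ≤ P.level + 1)]

theorem toList_length_le_one (a : Option ℕ) : a.toList.length ≤ 1 := by cases a <;> simp

theorem onRead_spec (P : Params) (hs : s.Wf) (hA : Live s A) (l v : ℕ) :
    Post (onRead l v) s fun _ s' => Advance P s A s' A 36 0 0 := by
  refine (tick_spec P hs 2).bind fun _ s₁ h₁ => Post.get ?_
  refine (checkAll_spec P h₁.wf l v (s₁.lastWriter l).toList).bind fun _ s₂ h₂ => Post.modify ?_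
  have h := Advance.of_quiet hA (h₁.trans h₂)
  have := toList_length_le_one (s₁.lastWriter l)
  exact ⟨h.toStep.set_readers (by rw [List.length_cons]; omega),
    ⟨h.live.lt_size, h.live.distinct⟩, h.charge_le⟩

theorem onWrite_spec (P : Params) (hs : s.Wf) (hA : Live s A) (l v : ℕ) :
    Post (onWrite l v) s fun _ s' => Advance P s A s' A 21 0 0 := by
  refine (tick_spec P hs 4).bind fun _ s₁ h₁ => Post.get ?_
  refine (checkAll_spec P h₁.wf l v (s₁.lastWriter l).toList).bind fun _ s₂ h₂ => Post.get ?_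
  refine (checkAll_spec P h₂.wf l v (s₂.readers l)).bind fun _ s₃ h₃ => Post.modify ?_
  have h := Advance.of_quiet hA ((h₁.trans h₂).trans h₃)
  have := toList_length_le_one (s₁.lastWriter l)
  exact ⟨h.toStep.set_readers (by rw [h₃.readers_eq, List.length_nil]; omega),
    ⟨h.live.lt_size, h.live.distinct⟩, h.charge_le⟩

end Memory

/-! ### The whole run -/

/-- The amortised cost of running `p` under the detector.  Each of the outstanding children `pend`
is paid for by the `sync` or `ret` of `p` that joins it. -/
def ExecBound (P : Params) (p : Code) : Prop :=
  ∀ {s : Detector} {A : List ℕ} {first cur : ℕ} {pend : List Pending}, s.Wf →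
    Frame s first pend → Live s (cur :: (liveOf pend ++ A)) →
    Post (exec p first cur pend) s fun t s' =>
      Advance P s (cur :: (liveOf pend ++ A)) s' (t :: A) (190 * p.work + 120 * pend.length)
        (3 * p.forks + p.futureOps + pend.length) (7 * p.futureOps)

section Exec

variable {P : Params} {s : Detector} {A : List ℕ} {first cur : ℕ} {pend : List Pending}
  {body rest : Code}

theorem ExecBound.nested (hbody : ExecBound P body) (hs : s.Wf) (hfirst : first < s.nsp.size)
    (hA : Live s (cur :: A)) : Post (exec body first cur []) s fun t s' =>
      Advance P s (cur :: A) s' (t :: A) (190 * body.work) (3 * body.forks + body.futureOps)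
        (7 * body.futureOps) :=
  hbody hs ⟨hfirst, by simp⟩ hA

theorem execBound_ret : ExecBound P .ret := fun hs hframe hA =>
  (tick_spec P hs 1).bind fun _ _ h₁ =>
    (onSync_spec P h₁.wf (hframe.mono h₁.le_size) (Advance.of_quiet hA h₁).live).mono
      fun _ _ h₂ => ((Advance.of_quiet hA h₁).trans h₂).weaken (by simp only [Code.work]; omega)
        (by omega) (by omega)

theorem execBound_compute (hrest : ExecBound P rest) : ExecBound P (.compute rest) :=
  fun hs hframe hA => (tick_spec P hs 1).bind fun _ _ h₁ =>
    (hrest h₁.wf (hframe.mono h₁.le_size) (Advance.of_quiet hA h₁).live).mono fun _ _ h₂ =>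
      ((Advance.of_quiet hA h₁).trans h₂).weaken (by simp only [Code.work]; omega)
        (by simp only [Code.forks, Code.futureOps]; omega) (by simp only [Code.futureOps]; omega)

theorem execBound_read (l : ℕ) (hrest : ExecBound P rest) : ExecBound P (.read l rest) :=
  fun hs hframe hA => (tick_spec P hs 1).bind fun _ _ h₁ =>
    (onRead_spec P h₁.wf (Advance.of_quiet hA h₁).live l _).bind fun _ _ h₂ =>
    have h₀₂ := (Advance.of_quiet hA h₁).trans h₂
    (hrest h₂.wf (hframe.mono h₀₂.le_size) h₂.live).mono fun _ _ h₃ =>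
      (h₀₂.trans h₃).weaken (by simp only [Code.work]; omega)
        (by simp only [Code.forks, Code.futureOps]; omega) (by simp only [Code.futureOps]; omega)

theorem execBound_write (l : ℕ) (hrest : ExecBound P rest) : ExecBound P (.write l rest) :=
  fun hs hframe hA => (tick_spec P hs 1).bind fun _ _ h₁ =>
    (onWrite_spec P h₁.wf (Advance.of_quiet hA h₁).live l _).bind fun _ _ h₂ =>
    have h₀₂ := (Advance.of_quiet hA h₁).trans h₂
    (hrest h₂.wf (hframe.mono h₀₂.le_size) h₂.live).mono fun _ _ h₃ =>
      (h₀₂.trans h₃).weaken (by simp only [Code.work]; omega)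
        (by simp only [Code.forks, Code.futureOps]; omega) (by simp only [Code.futureOps]; omega)

theorem execBound_call (hbody : ExecBound P body) (hrest : ExecBound P rest) :
    ExecBound P (.call body rest) :=
  fun hs hframe hA => (tick_spec P hs 1).bind fun _ _ h₁ =>
    have h₀₁ := Advance.of_quiet hA h₁
    (hbody.nested h₁.wf (hframe.mono h₁.le_size).first_lt h₀₁.live).bind fun _ _ h₂ =>
    have h₀₂ := h₀₁.trans h₂
    (hrest h₂.wf (hframe.mono h₀₂.le_size) h₂.live).mono fun _ _ h₃ =>
      (h₀₂.trans h₃).weaken (by simp only [Code.work]; omega)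
        (by simp only [Code.forks, Code.futureOps]; omega) (by simp only [Code.futureOps]; omega)

theorem execBound_spawn (hbody : ExecBound P body) (hrest : ExecBound P rest) :
    ExecBound P (.spawn body rest) := by
  intro s A first cur pend hs hframe hA
  refine (tick_spec P hs 1).bind fun _ s₁ h₁ => ?_
  have h₀₁ := Advance.of_quiet hA h₁
  refine (onSpawn_spec P h₁.wf (hframe.mono h₁.le_size).first_lt h₀₁.live).bind
    fun (v, w) s₂ h₂ => ?_
  have hv : v < s₂.nsp.size := h₂.live.lt_size v (by simp)
  have hw : w < s₂.nsp.size := h₂.live.lt_size w (by simp)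
  refine (hbody.nested h₂.wf hv h₂.live).bind fun t s₃ h₃ =>
    (toP_spec P h₃.wf v).bind fun _ s₄ h₄ => ?_
  have hp : (w :: (liveOf (⟨cur, v, w, t⟩ :: pend) ++ A)).Perm
      (t :: w :: cur :: (liveOf pend ++ A)) := by
    simp only [liveOf, List.flatMap_cons]
    grind
  have h₂₄ := (h₃.trans_quiet h₄).subperm hp.subperm
  have h₀₄ := (h₀₁.trans h₂).trans h₂₄
  have hframe₄ : Frame s₄ first (⟨cur, v, w, t⟩ :: pend) :=
    ⟨hframe.first_lt.trans_le h₀₄.le_size, List.forall_mem_cons.mpr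
      ⟨⟨hv.trans_le h₂₄.le_size, hw.trans_le h₂₄.le_size⟩, (hframe.mono h₀₄.le_size).branch_lt⟩⟩
  exact (hrest h₂₄.wf hframe₄ h₂₄.live).mono fun _ _ h₅ => (h₀₄.trans h₅).weaken
    (by simp only [Code.work, List.length_cons]; omega)
    (by simp only [Code.forks, Code.futureOps, List.length_cons]; omega)
    (by simp only [Code.futureOps]; omega)

theorem execBound_create (hbody : ExecBound P body) (hrest : ExecBound P rest) :
    ExecBound P (.create body rest) := by
  intro s A first cur pend hs hframe hA
  refine (tick_spec P hs 1).bind fun _ s₁ h₁ => ?_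
  have h₀₁ := Advance.of_quiet hA h₁
  refine (onCreate_spec P h₁.wf (hframe.mono h₁.le_size).first_lt h₀₁.live).bind
    fun (v, w) s₂ h₂ => (newFuture_spec P h₂.wf).bind fun i s₃ h₃ => ?_
  have h₀₃ := (h₀₁.trans h₂).trans_quiet h₃
  refine (hbody.nested h₃.wf (h₀₃.live.lt_size v (by simp)) h₀₃.live).bind fun t s₄ h₄ =>
    (toP_spec P h₄.wf v).bind fun _ s₅ h₅ => (finishFuture_spec P h₅.wf i t).bind fun _ s₆ h₆ => ?_
  have h₀₆ := ((h₀₃.trans h₄).trans_quiet (h₅.trans h₆)).tail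
  exact (hrest h₆.wf (hframe.mono h₀₆.le_size) h₀₆.live).mono fun _ _ h₇ =>
    (h₀₆.trans h₇).weaken (by simp only [Code.work]; omega)
      (by simp only [Code.forks, Code.futureOps]; omega) (by simp only [Code.futureOps]; omega)

theorem execBound_get (i : ℕ) (hrest : ExecBound P rest) : ExecBound P (.get i rest) :=
  fun hs hframe hA => (tick_spec P hs 1).bind fun _ _ h₁ =>
    have h₀₁ := Advance.of_quiet hA h₁
    (onGet_spec P h₁.wf (hframe.mono h₁.le_size).first_lt h₀₁.live i).bind fun _ _ h₂ =>
    have h₀₂ := h₀₁.trans h₂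
    (hrest h₂.wf (hframe.mono h₀₂.le_size) h₂.live).mono fun _ _ h₃ =>
      (h₀₂.trans h₃).weaken (by simp only [Code.work]; omega)
        (by simp only [Code.forks, Code.futureOps]; omega) (by simp only [Code.futureOps]; omega)

theorem execBound_sync (hrest : ExecBound P rest) : ExecBound P (.sync rest) :=
  fun hs hframe hA => (tick_spec P hs 1).bind fun _ _ h₁ =>
    have h₀₁ := Advance.of_quiet hA h₁
    (onSync_spec P h₁.wf (hframe.mono h₁.le_size) h₀₁.live).bind fun _ _ h₂ =>
    have h₀₂ := h₀₁.trans h₂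
    (hrest.nested h₂.wf (hframe.mono h₀₂.le_size).first_lt h₂.live).mono fun _ _ h₃ =>
      (h₀₂.trans h₃).weaken (by simp only [Code.work]; omega)
        (by simp only [Code.forks, Code.futureOps]; omega) (by simp only [Code.futureOps]; omega)

end Exec

theorem execBound (P : Params) (p : Code) : ExecBound P p := by
  induction p with
  | ret => exact execBound_ret
  | compute _ hrest => exact execBound_compute hrest
  | read l _ hrest => exact execBound_read l hrest
  | write l _ hrest => exact execBound_write l hrest
  | call _ _ hbody hrest => exact execBound_call hbody hrest
  | spawn _ _ hbody hrest => exact execBound_spawn hbody hrest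
  | create _ _ hbody hrest => exact execBound_create hbody hrest
  | get i _ hrest => exact execBound_get i hrest
  | sync _ hrest => exact execBound_sync hrest

theorem multiBagsPlus_spec (P : Params) (p : Code) :
    Advance P .init [] (multiBagsPlus p) [] (190 * p.work + 26) (3 * p.forks + p.futureOps + 1)
      (7 * p.futureOps + 3) := by
  have hinit : Live .init [] := ⟨by simp, by simp⟩
  let run : DetM Unit := do
    let x ← newStrand
    attachNew x []
    let _ ← exec p x x []
    toP x
  suffices Post run .init fun _ s => Advance P .init [] s [] (190 * p.work + 26)
      (3 * p.forks + p.futureOps + 1) (7 * p.futureOps + 3) from this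
  refine (newStrand_live_spec P Detector.init_wf hinit).bind fun x s₁ ⟨h₁, _, _⟩ =>
    (attachNew_spec P h₁.wf h₁.live (by simp)).bind fun _ s₂ h₂ => ?_
  refine (ExecBound.nested (execBound P p) h₂.wf (h₂.live.lt_size x (by simp)) h₂.live).bind
    fun t s₃ h₃ => (toP_spec P h₃.wf x).mono fun _ s₄ h₄ => ?_
  exact ((h₁.trans h₂).trans (h₃.trans_quiet h₄).tail).weaken (by omega) (by omega) (by omega)

theorem length_insertLog_le (p : Code) :
    (multiBagsPlus p).insertLog.length ≤ 7 * p.futureOps + 3 := by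
  simpa [Detector.charge, Detector.init] using
    (multiBagsPlus_spec ⟨0, 0, 0, by simp⟩ p).charge_le

theorem insertLog_le (p : Code) : ∀ c ∈ (multiBagsPlus p).insertLog, c ≤ 35 * p.futureOps + 18 :=
  fun c hc => by
    have := (multiBagsPlus_spec ⟨0, 0, 0, by simp⟩ p).wf.insertLog_le c hc
    have := length_insertLog_le p
    omega

theorem sum_insertLog_le (p : Code) :
    (multiBagsPlus p).insertLog.sum ≤ (7 * p.futureOps + 3) * (35 * p.futureOps + 18) :=
  (List.sum_le_card_nsmul _ _ (insertLog_le p)).trans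
    (Nat.mul_le_mul_right _ (length_insertLog_le p))

theorem steps_le {p : Code} {i b : ℕ}
    (h : Nat.log 2 (3 * p.forks + p.futureOps + 1) ≤ ack i (b + 1)) :
    (multiBagsPlus p).steps ≤ (multiBagsPlus p).insertLog.sum +
      4 * b * (3 * p.forks + p.futureOps + 1) + (190 * p.work + 26) * (i + 1) := by
  have hstep := (multiBagsPlus_spec ⟨i, b, 3 * p.forks + p.futureOps + 1, h⟩ p).toStep
  have hsize : (multiBagsPlus p).nsp.size ≤ 3 * p.forks + p.futureOps + 1 :=
    hstep.size_le.trans (Nat.zero_add _).le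
  have hbalance := hstep.balance_le hsize
  rw [Detector.balance_init, Detector.balance] at hbalance
  have hbase := Nat.mul_le_mul_left (4 * b) hsize
  push_cast at hbalance
  zify at hbase
  have hprepaid : (0 : ℤ) ≤ 17 * (i + 1) * (multiBagsPlus p).pendingReads := by positivity
  exact Int.ofNat_le.mp (by push_cast; linarith)

theorem Code.accesses_lt_work (p : Code) : p.accesses < p.work := by
  induction p <;> simp only [accesses, work] <;> omega

theorem Code.forks_lt_work (p : Code) : p.forks < p.work := by
  induction p <;> simp only [forks, work] <;> omega

theorem Code.futureOps_lt_work (p : Code) : p.futureOps < p.work := by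
  induction p <;> simp only [futureOps, work] <;> omega

theorem invAck_mem (m n : ℕ) : 1 ≤ invAck m n ∧ Nat.clog 2 n ≤ ack (invAck m n) (m / n) :=
  Nat.sInf_mem (s := {i : ℕ | 1 ≤ i ∧ Nat.clog 2 n ≤ ack i (m / n)})
    ⟨Nat.clog 2 n + 1, by omega, ((Nat.lt_succ_self _).trans (lt_ack_left _ _)).le⟩

/-- The allowance `4 * b * (3 * n + k + 1)` for allocating strands at base `b = m / n + 1` is within
the work, because `m / n * n ≤ m`. -/
theorem steps_le_of_futureOps_le_forks {p : Code} (h : p.futureOps ≤ p.forks) :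
    (multiBagsPlus p).steps ≤ (multiBagsPlus p).insertLog.sum + 40 * p.work +
      432 * (p.work * invAck p.accesses p.forks) := by
  obtain ⟨hα, hack⟩ := invAck_mem p.accesses p.forks
  have hm := p.accesses_lt_work
  have hn := p.forks_lt_work
  set d := p.accesses / p.forks
  have hdm : d ≤ p.accesses := Nat.div_le_self _ _
  have hdn : d * p.forks ≤ p.accesses := Nat.div_mul_le_self _ _
  have hlog : Nat.log 2 (3 * p.forks + p.futureOps + 1) ≤ Nat.clog 2 p.forks + 2 := by
    have := Nat.le_pow_clog one_lt_two p.forks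
    have := Nat.one_le_two_pow (n := Nat.clog 2 p.forks)
    exact Nat.le_of_lt_succ (Nat.log_lt_of_lt_pow (by omega) (by rw [pow_succ, pow_add]; omega))
  have hrank : Nat.log 2 (3 * p.forks + p.futureOps + 1) ≤
      ack (invAck p.accesses p.forks) (d + 1 + 1) := by
    have := (ack_strictMono_right (invAck p.accesses p.forks)).add_le_nat 2 d
    rw [show d + 1 + 1 = 2 + d by omega]
    omega
  have hstrands : 4 * (d + 1) * (3 * p.forks + p.futureOps + 1) ≤ 40 * p.work := by nlinarith
  have hwork : (190 * p.work + 26) * (invAck p.accesses p.forks + 1) ≤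
      432 * (p.work * invAck p.accesses p.forks) := by nlinarith
  have := steps_le hrank
  omega

theorem steps_le_of_forks_lt_futureOps {p : Code} (h : p.forks < p.futureOps) :
    (multiBagsPlus p).steps ≤ (multiBagsPlus p).insertLog.sum + 64 * p.futureOps ^ 2 +
      432 * p.work := by
  have hrank : Nat.log 2 (3 * p.forks + p.futureOps + 1) ≤ ack 1 (4 * p.futureOps + 1) := by
    rw [ack_one]
    exact (Nat.log_le_self _ _).trans (by omega)
  have hstrands : 4 * (4 * p.futureOps) * (3 * p.forks + p.futureOps + 1) ≤
      64 * p.futureOps ^ 2 := by nlinarith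
  have := steps_le hrank
  have := p.forks_lt_work
  omega

theorem steps_le_invAck (p : Code) : (multiBagsPlus p).steps ≤
    1000 * (p.work * invAck p.accesses p.forks + p.futureOps ^ 2) := by
  have hk := p.futureOps_lt_work
  have hα : p.work ≤ p.work * invAck p.accesses p.forks :=
    Nat.le_mul_of_pos_right _ (invAck_mem p.accesses p.forks).1
  have hsum : (multiBagsPlus p).insertLog.sum ≤ 245 * p.futureOps ^ 2 + 285 * p.work :=
    (sum_insertLog_le p).trans (by nlinarith)
  rcases le_or_gt p.futureOps p.forks with h | h
  · have := steps_le_of_futureOps_le_forks h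
    omega
  · have := steps_le_of_forks_lt_futureOps h
    omega

end FutureRace

theorem mainTheorem1_general (p : FutureRace.Code) :
    (FutureRace.multiBagsPlus p).steps ≤
        1000 * (p.work * FutureRace.invAck p.accesses p.forks + p.futureOps ^ 2) ∧
      (FutureRace.multiBagsPlus p).insertLog.length ≤ 1000 * (p.futureOps + 1) ∧
      ∀ c ∈ (FutureRace.multiBagsPlus p).insertLog, c ≤ 1000 * (p.futureOps + 1) :=
  ⟨FutureRace.steps_le_invAck p, (FutureRace.length_insertLog_le p).trans (by omega),
    fun c hc => (FutureRace.insertLog_le p c hc).trans (by omega)⟩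

theorem mainTheorem1 :
    ∃ C : ℕ, ∀ p : FutureRace.Code, p.Runs →
      (FutureRace.multiBagsPlus p).steps ≤
          C * (p.work * FutureRace.invAck p.accesses p.forks + p.futureOps ^ 2) ∧
        (FutureRace.multiBagsPlus p).insertLog.length ≤ C * (p.futureOps + 1) ∧
        ∀ c ∈ (FutureRace.multiBagsPlus p).insertLog, c ≤ C * (p.futureOps + 1) :=
  ⟨1000, fun p _ => mainTheorem1_general p⟩
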